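/- Let $\mathsf X$ be a finite set, and let $(G,\mathsf X)$ be a self-similar group, that is, a group $G$ with a faithful action by isometries on the space $\mathsf X^\omega$ of infinite words (with metric $d(u,v)=2^{-|u\wedge v|}$, where $u\wedge v$ is the longest common prefix of $u,v$) such that for all $g\in G$, $x\in\mathsf X$ there is $g|_x\in G$ with $g(xw)=g(x)\,g|_x(w)$ for all $w\in\mathsf X^\omega$. Put $g|_\emptyset=g$ and $g|_{xu}=(g|_x)|_u$ for finite words. Assume that $(G,\mathsf X)$ is contracting: there is a finite set $N\subseteq G$ with $n|_x\in N$ for all $n\in N$, $x\in\mathsf X$, and such that for every $g\in G$ there is $m\ge 0$ with $g|_w\in N$ for all words $w$ of length $m$. Let $\mathbb C(G,\mathsf X)$ be the universal unital complex $*$-algebra generated by $u_g$ ($g\in G$) and $s_x$ ($x\in\mathsf X$) subject to the relations: $g\mapsto u_g$ is a unitary representation of $G$; $u_gs_x=s_{g(x)}u_{g|_x}$; $s_x^*s_y=\delta_{x,y}$; and $\sum_{x\in\mathsf X}s_xs_x^*=1$. Let $S(G,\mathsf X)$ be the inverse semigroup with zero defined by the same generators and all of these relations but the last; it acts on $\mathsf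 X^\omega$ by partial homeomorphisms, $s_vu_gs_w^*$ mapping $w\rho$ to $v\,g(\rho)$. Let $\mathcal G=\mathcal G(G,\mathsf X)$ be the ample groupoid of germs of this action, and let $\mathbb C\mathcal G$ be the convolution algebra of functions on $\mathcal G$ generated by the indicator functions of the compact open bisections. The algebraic essential ideal of $\mathbb C\mathcal G$ consists of the $f\in\mathbb C\mathcal G$ whose strict support $\{\gamma\in\mathcal G : f(\gamma)\neq 0\}$ has empty interior. Let $I_{\mathrm{ess}}^{\mathrm{alg}}(\mathcal G)$ be the corresponding ideal of $\mathbb C(G,\mathsf X)$, that is, its preimage under the canonical homomorphism $\mathbb C(G,\mathsf X)\to\mathbb C\mathcal G$ which maps $u_g$ and $s_x$ to the indicator functions of the sets of germs of $w\mapsto g(w)$ and $w\mapsto xw$. Then $\mathbb C(G,\mathsf X)/I_{\mathrm{ess}}^{\mathrm{alg}}(\mathcal G)$ is a finitely presented $\mathbb C$-algebra: it is isomorphic to the quotient of a free associative unital algebra of finite rank by a two-sided ideal generated by a finite set. -/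

import Mathlib

set_option linter.unusedSectionVars false

/-! ## Groupoids presented by their arrows -/

/-- A groupoid (a small category in which every arrow is invertible), given by its set of arrows
`𝒢` and its set of objects `Ω`; the object `x` is identified with the arrow `unit x`.
The product `mul a b` is defined if and only if `src a = rng b`. -/
class ArrowGroupoid (𝒢 : Type*) (Ω : outParam Type*) where
  src : 𝒢 → Ω
  rng : 𝒢 → Ω
  unit : Ω → 𝒢
  mul : (a b : 𝒢) → src a = rng b → 𝒢
  inv : 𝒢 → 𝒢
  src_unit : ∀ x, src (unit x) = x
  rng_unit : ∀ x, rng (unit x) = x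
  src_mul : ∀ a b h, src (mul a b h) = src b
  rng_mul : ∀ a b h, rng (mul a b h) = rng a
  src_inv : ∀ a, src (inv a) = rng a
  rng_inv : ∀ a, rng (inv a) = src a
  mul_unit : ∀ a, mul a (unit (src a)) (rng_unit _).symm = a
  unit_mul : ∀ a, mul (unit (rng a)) a (src_unit _) = a
  mul_assoc : ∀ a b c (h₁ : src a = rng b) (h₂ : src b = rng c),
    mul (mul a b h₁) c ((src_mul a b h₁).trans h₂) = mul a (mul b c h₂) (h₁.trans (rng_mul b c h₂).symm)
  mul_inv : ∀ a, mul a (inv a) (rng_inv a).symm = unit (rng a)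
  inv_mul : ∀ a, mul (inv a) a (src_inv a) = unit (src a)

namespace ArrowGroupoid

section Basic

variable {𝒢 Ω : Type*} [ArrowGroupoid 𝒢 Ω]

/-- The product as a total operation; only used for composable arrows. -/
noncomputable def tmul (a b : 𝒢) : 𝒢 :=
  open scoped Classical in if h : src a = rng b then mul a b h else a

theorem tmul_eq {a b : 𝒢} (h : src a = rng b) : tmul a b = mul a b h := dif_pos h

theorem src_tmul {a b : 𝒢} (h : src a = rng b) : src (tmul a b) = src b := by
  rw [tmul_eq h, src_mul]

theorem rng_tmul {a b : 𝒢} (h : src a = rng b) : rng (tmul a b) = rng a := by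
  rw [tmul_eq h, rng_mul]

theorem tmul_assoc {a b c : 𝒢} (h₁ : src a = rng b) (h₂ : src b = rng c) :
    tmul (tmul a b) c = tmul a (tmul b c) := by
  have e₁ : src (mul a b h₁) = rng c := (src_mul a b h₁).trans h₂
  have e₂ : src a = rng (mul b c h₂) := h₁.trans (rng_mul b c h₂).symm
  rw [tmul_eq h₁, tmul_eq h₂, tmul_eq e₁, tmul_eq e₂, mul_assoc]

theorem tmul_unit (a : 𝒢) : tmul a (unit (src a)) = a := by
  rw [tmul_eq (rng_unit _).symm, mul_unit]

theorem unit_tmul (a : 𝒢) : tmul (unit (rng a)) a = a := by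
  rw [tmul_eq (src_unit _), unit_mul]

theorem tmul_inv (a : 𝒢) : tmul a (inv a) = unit (rng a) := by
  rw [tmul_eq (rng_inv a).symm, mul_inv]

theorem inv_tmul (a : 𝒢) : tmul (inv a) a = unit (src a) := by
  rw [tmul_eq (src_inv a), inv_mul]

theorem tmul_inv_cancel {a b : 𝒢} (h : src a = rng b) : tmul (tmul a b) (inv b) = a := by
  rw [tmul_assoc h (rng_inv b).symm, tmul_inv, ← h, tmul_unit]

theorem tmul_inv_tmul {a b : 𝒢} (h : src a = src b) : tmul (tmul a (inv b)) b = a := by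
  rw [tmul_assoc (h.trans (rng_inv b).symm) (src_inv b), inv_tmul, ← h, tmul_unit]

theorem inv_tmul_cancel {a b : 𝒢} (h : src a = rng b) : tmul (inv a) (tmul a b) = b := by
  rw [← tmul_assoc (src_inv a) h, inv_tmul, h, unit_tmul]

theorem tmul_inv_tmul' {a b : 𝒢} (h : rng a = rng b) : tmul a (tmul (inv a) b) = b := by
  rw [← tmul_assoc (rng_inv a).symm ((src_inv a).trans h), tmul_inv, h, unit_tmul]

theorem inv_inv (a : 𝒢) : inv (inv a) = a := by
  have h := tmul_inv_tmul' (a := inv a) (b := unit (src a)) (by rw [rng_inv, rng_unit])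
  have h2 := inv_tmul_cancel (a := inv a) (b := a) (src_inv a)
  rw [inv_tmul] at h2
  have h3 := tmul_unit (inv (inv a))
  rw [src_inv, rng_inv] at h3
  exact h3.symm.trans h2

theorem inv_tmul_rev {a b : 𝒢} (h : src a = rng b) :
    inv (tmul a b) = tmul (inv b) (inv a) := by
  have hc : src (inv b) = rng (inv a) := by rw [src_inv, rng_inv, h]
  have h1 : tmul (tmul a b) (tmul (inv b) (inv a)) = unit (rng a) := by
    rw [← tmul_assoc (by rw [src_tmul h, rng_inv]) hc, tmul_inv_cancel h, tmul_inv]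
  have h2 := inv_tmul_cancel (a := tmul a b) (b := tmul (inv b) (inv a))
    (by rw [src_tmul h, rng_tmul hc, rng_inv])
  rw [h1] at h2
  rw [← h2]
  have h3 := tmul_unit (inv (tmul a b))
  rw [src_inv, rng_tmul h] at h3
  exact h3.symm

/-- `a b⁻¹`, for arrows with the same source. -/
noncomputable def div (a b : 𝒢) : 𝒢 := tmul a (inv b)

theorem src_div {a b : 𝒢} (h : src a = src b) : src (div a b) = rng b := by
  rw [div, src_tmul (h.trans (rng_inv b).symm), src_inv]

theorem rng_div {a b : 𝒢} (h : src a = src b) : rng (div a b) = rng a :=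
  rng_tmul (h.trans (rng_inv b).symm)

theorem div_tmul {a b : 𝒢} (h : src a = src b) : tmul (div a b) b = a := tmul_inv_tmul h

theorem tmul_div {a b : 𝒢} (h : src a = rng b) : div (tmul a b) b = a := tmul_inv_cancel h

theorem div_tmul_eq {a b c : 𝒢} (h : src b = rng c) (h' : src a = src c) :
    div a (tmul b c) = div (div a c) b := by
  rw [div, inv_tmul_rev h, ← tmul_assoc (by rw [rng_inv, h']) (by rw [src_inv, rng_inv, h])]
  rfl

theorem div_self (a : 𝒢) : div a a = unit (rng a) := tmul_inv a

theorem eq_of_div_eq_unit {a b : 𝒢} {x : Ω} (h : src a = src b) (h' : div a b = unit x) :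
    b = a := by
  have h1 := div_tmul h
  have h2 : x = rng b := by rw [← src_div h, h', src_unit]
  rw [h', h2, unit_tmul] at h1
  exact h1

theorem div_unit (a : 𝒢) : div a (unit (src a)) = a := by
  have h := tmul_div (a := a) (b := unit (src a)) (rng_unit _).symm
  rwa [tmul_unit] at h

/-! ## The convolution algebra -/

variable (𝒢) in
/-- Functions on the groupoid with finite support on every source fibre. They contain all the
compactly supported functions on an étale groupoid, and their convolution is a finite sum. -/
def columnFinite : Submodule ℂ (𝒢 → ℂ) where
  carrier := {f | ∀ x : Ω, {γ : 𝒢 | src γ = x ∧ f γ ≠ 0}.Finite}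
  zero_mem' := by intro x; simp
  add_mem' := by
    intro f g hf hg x
    refine ((hf x).union (hg x)).subset ?_
    rintro γ ⟨h1, h2⟩
    by_cases h : f γ = 0
    · exact Or.inr ⟨h1, fun h' => h2 (by simp [h, h'])⟩
    · exact Or.inl ⟨h1, h⟩
  smul_mem' := by
    intro c f hf x
    refine (hf x).subset ?_
    rintro γ ⟨h1, h2⟩
    exact ⟨h1, fun h' => h2 (by simp [h'])⟩

/-- The convolution `(f₁ f₂)(γ) = ∑_{γ₁ γ₂ = γ} f₁(γ₁) f₂(γ₂)`. -/
noncomputable def conv (f₁ f₂ : 𝒢 → ℂ) (γ : 𝒢) : ℂ :=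
  ∑ᶠ (p : 𝒢 × 𝒢) (_ : ∃ h : src p.1 = rng p.2, mul p.1 p.2 h = γ), f₁ p.1 * f₂ p.2

theorem conv_eq_sum (f₁ f₂ : 𝒢 → ℂ) (γ : 𝒢) (T : Finset 𝒢) (hT : ∀ b ∈ T, src b = src γ)
    (hT' : ∀ b, src b = src γ → f₂ b ≠ 0 → b ∈ T) :
    conv f₁ f₂ γ = ∑ b ∈ T, f₁ (div γ b) * f₂ b := by
  classical
  have hi : Function.Injective fun b : 𝒢 => (div γ b, b) := fun a b h => (Prod.ext_iff.1 h).2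
  rw [← Finset.sum_image (f := fun p : 𝒢 × 𝒢 => f₁ p.1 * f₂ p.2) (g := fun b : 𝒢 => (div γ b, b))
    (fun a _ b _ h => hi h)]
  unfold conv
  refine finsum_mem_eq_sum_of_inter_support_eq
    (s := {p : 𝒢 × 𝒢 | ∃ h : src p.1 = rng p.2, mul p.1 p.2 h = γ})
    (fun p : 𝒢 × 𝒢 => f₁ p.1 * f₂ p.2) ?_
  ext ⟨a, b⟩
  simp only [Set.mem_inter_iff, Set.mem_ofPred_eq, Function.mem_support, Finset.coe_image,
    Set.mem_image, Finset.mem_coe, Prod.mk.injEq]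
  constructor
  · rintro ⟨⟨h, rfl⟩, hne⟩
    refine ⟨⟨b, hT' b (src_mul _ _ _).symm (right_ne_zero_of_mul hne), ?_, rfl⟩, hne⟩
    rw [← tmul_eq h, tmul_div h]
  · rintro ⟨⟨b', hb', rfl, rfl⟩, hne⟩
    have h := (hT _ hb').symm
    refine ⟨⟨src_div h, ?_⟩, hne⟩
    rw [← tmul_eq (src_div h), div_tmul h]

variable (𝒢) in
/-- The algebra of column-finite functions under convolution. -/
abbrev ConvAlg : Type _ := columnFinite 𝒢

namespace ConvAlg

instance : CoeFun (ConvAlg 𝒢) (fun _ => 𝒢 → ℂ) := ⟨Subtype.val⟩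

theorem ext' {f g : ConvAlg 𝒢} (h : ∀ γ, f γ = g γ) : f = g := Subtype.ext (funext h)

@[simp] theorem add_apply (f g : ConvAlg 𝒢) (γ : 𝒢) : (f + g) γ = f γ + g γ := rfl
@[simp] theorem zero_apply (γ : 𝒢) : (0 : ConvAlg 𝒢) γ = 0 := rfl
@[simp] theorem neg_apply (f : ConvAlg 𝒢) (γ : 𝒢) : (-f) γ = -f γ := rfl
@[simp] theorem smul_apply (c : ℂ) (f : ConvAlg 𝒢) (γ : 𝒢) : (c • f) γ = c * f γ := rfl

/-- The part of the support of `f` in the fibre over `x`. -/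
noncomputable def fib (f : ConvAlg 𝒢) (x : Ω) : Finset 𝒢 := (f.2 x).toFinset

theorem mem_fib {f : ConvAlg 𝒢} {x : Ω} {γ : 𝒢} : γ ∈ fib f x ↔ src γ = x ∧ f γ ≠ 0 := by
  simp [fib]

theorem conv_eq (f₁ : 𝒢 → ℂ) (f₂ : ConvAlg 𝒢) (γ : 𝒢) :
    conv f₁ f₂ γ = ∑ b ∈ fib f₂ (src γ), f₁ (div γ b) * f₂ b :=
  conv_eq_sum _ _ _ _ (fun _ hb => (mem_fib.1 hb).1) (fun _ h h' => mem_fib.2 ⟨h, h'⟩)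

theorem conv_mem (f₁ f₂ : ConvAlg 𝒢) : conv f₁ f₂ ∈ columnFinite 𝒢 := by
  classical
  intro x
  refine (((fib f₂ x).biUnion fun c => (fib f₁ (rng c)).image fun b => tmul b c).finite_toSet).subset
    ?_
  rintro γ ⟨rfl, h2⟩
  rw [conv_eq] at h2
  obtain ⟨c, hc, hne⟩ := Finset.exists_ne_zero_of_sum_ne_zero h2
  have hs : src γ = src c := ((mem_fib.1 hc).1).symm
  simp only [Finset.coe_biUnion, Finset.mem_coe, Set.mem_iUnion, Finset.coe_image, Set.mem_image]
  exact ⟨c, hc, div γ c, mem_fib.2 ⟨src_div hs, left_ne_zero_of_mul hne⟩, div_tmul hs⟩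

noncomputable instance : Mul (ConvAlg 𝒢) := ⟨fun f g => ⟨conv f g, conv_mem f g⟩⟩

open scoped Classical in
/-- The unit is the indicator function of the set of units. -/
noncomputable instance : One (ConvAlg 𝒢) :=
  ⟨⟨(Set.range (unit : Ω → 𝒢)).indicator 1, by
    intro x
    refine (Set.finite_singleton (unit x)).subset ?_
    rintro γ ⟨rfl, h⟩
    obtain ⟨y, rfl⟩ := Set.mem_of_indicator_ne_zero h
    rw [src_unit]; rfl⟩⟩

theorem mul_apply (f g : ConvAlg 𝒢) (γ : 𝒢) :
    (f * g) γ = ∑ b ∈ fib g (src γ), f (div γ b) * g b := conv_eq f g γ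

theorem mul_apply_of (f g : ConvAlg 𝒢) (γ : 𝒢) (T : Finset 𝒢) (hT : ∀ b ∈ T, src b = src γ)
    (hT' : ∀ b, src b = src γ → g b ≠ 0 → b ∈ T) :
    (f * g) γ = ∑ b ∈ T, f (div γ b) * g b := conv_eq_sum _ _ _ T hT hT'

theorem one_apply (γ : 𝒢) :
    (1 : ConvAlg 𝒢) γ = (Set.range (unit : Ω → 𝒢)).indicator (1 : 𝒢 → ℂ) γ := rfl

theorem mul_one' (f : ConvAlg 𝒢) : f * 1 = f := by
  refine ext' fun γ => ?_
  rw [mul_apply_of f 1 γ {unit (src γ)} (by simp [src_unit])]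
  · rw [Finset.sum_singleton, div_unit, one_apply, Set.indicator_of_mem (Set.mem_range_self _)]; simp
  · intro b hb h
    obtain ⟨y, rfl⟩ := Set.mem_of_indicator_ne_zero h
    rw [src_unit] at hb
    simp [hb]

theorem one_mul' (f : ConvAlg 𝒢) : 1 * f = f := by
  classical
  refine ext' fun γ => ?_
  rw [mul_apply_of 1 f γ (insert γ (fib f (src γ)))]
  · rw [Finset.sum_eq_single γ]
    · rw [div_self, one_apply, Set.indicator_of_mem (Set.mem_range_self _)]; simp
    · intro b hb hne
      rw [one_apply, Set.indicator_of_notMem, zero_mul]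
      rintro ⟨y, hy⟩
      have hs : src γ = src b := by
        rcases Finset.mem_insert.1 hb with rfl | h
        · rfl
        · exact ((mem_fib.1 h).1).symm
      exact hne (eq_of_div_eq_unit hs hy.symm)
    · intro h; exact absurd (Finset.mem_insert_self _ _) h
  · intro b hb
    rcases Finset.mem_insert.1 hb with rfl | h
    · rfl
    · exact (mem_fib.1 h).1
  · intro b hb h
    exact Finset.mem_insert_of_mem (mem_fib.2 ⟨hb, h⟩)

theorem add_mul' (f g h : ConvAlg 𝒢) : (f + g) * h = f * h + g * h := by
  refine ext' fun γ => ?_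
  simp only [mul_apply, add_apply, add_mul, Finset.sum_add_distrib]

theorem mul_add' (f g h : ConvAlg 𝒢) : f * (g + h) = f * g + f * h := by
  classical
  refine ext' fun γ => ?_
  have hT : ∀ b ∈ fib g (src γ) ∪ fib h (src γ), src b = src γ := by
    intro b hb
    rcases Finset.mem_union.1 hb with hb | hb <;> exact (mem_fib.1 hb).1
  rw [add_apply, mul_apply_of f (g + h) γ _ hT, mul_apply_of f g γ _ hT, mul_apply_of f h γ _ hT,
    ← Finset.sum_add_distrib]
  · exact Finset.sum_congr rfl fun b _ => by rw [add_apply]; ring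
  · exact fun b hb h' => Finset.mem_union_right _ (mem_fib.2 ⟨hb, h'⟩)
  · exact fun b hb h' => Finset.mem_union_left _ (mem_fib.2 ⟨hb, h'⟩)
  · intro b hb h'
    by_cases h0 : g b = 0
    · exact Finset.mem_union_right _ (mem_fib.2 ⟨hb, fun h1 => h' (by simp [h0, h1])⟩)
    · exact Finset.mem_union_left _ (mem_fib.2 ⟨hb, h0⟩)

theorem smul_mul' (c : ℂ) (f g : ConvAlg 𝒢) : (c • f) * g = c • (f * g) := by
  refine ext' fun γ => ?_
  simp only [mul_apply, smul_apply, Finset.mul_sum, _root_.mul_assoc]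

theorem mul_smul' (c : ℂ) (f g : ConvAlg 𝒢) : f * (c • g) = c • (f * g) := by
  refine ext' fun γ => ?_
  have hT : ∀ b ∈ fib g (src γ), src b = src γ := fun b hb => (mem_fib.1 hb).1
  rw [smul_apply, mul_apply_of f (c • g) γ _ hT, mul_apply f g, Finset.mul_sum]
  · exact Finset.sum_congr rfl fun b _ => by rw [smul_apply]; ring
  · intro b hb h'
    exact mem_fib.2 ⟨hb, fun h1 => h' (by simp [h1])⟩

theorem mul_assoc' (f₁ f₂ f₃ : ConvAlg 𝒢) : (f₁ * f₂) * f₃ = f₁ * (f₂ * f₃) := by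
  classical
  refine ext' fun γ => ?_
  set D := fib f₃ (src γ) with hD
  have hDs : ∀ c ∈ D, src c = src γ := fun c hc => (mem_fib.1 hc).1
  set T : Finset 𝒢 := D.biUnion fun c => (fib f₂ (rng c)).image fun b => tmul b c with hTdef
  have hT : ∀ d ∈ T, src d = src γ := by
    intro d hd
    simp only [hTdef, Finset.mem_biUnion, Finset.mem_image] at hd
    obtain ⟨c, hc, b, hb, rfl⟩ := hd
    rw [src_tmul (mem_fib.1 hb).1, hDs c hc]
  have hmem : ∀ d c, src d = src γ → c ∈ D → f₂ (div d c) ≠ 0 → d ∈ T := by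
    intro d c hd hc h
    have hs : src d = src c := hd.trans (hDs c hc).symm
    simp only [hTdef, Finset.mem_biUnion, Finset.mem_image]
    exact ⟨c, hc, div d c, mem_fib.2 ⟨src_div hs, h⟩, div_tmul hs⟩
  have hT' : ∀ d, src d = src γ → (f₂ * f₃) d ≠ 0 → d ∈ T := by
    intro d hd h
    rw [mul_apply, hd] at h
    obtain ⟨c, hc, hne⟩ := Finset.exists_ne_zero_of_sum_ne_zero h
    exact hmem d c hd hc (left_ne_zero_of_mul hne)
  have hR : (f₁ * (f₂ * f₃)) γ
      = ∑ c ∈ D, ∑ d ∈ T, f₁ (div γ d) * (f₂ (div d c) * f₃ c) := by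
    rw [mul_apply_of f₁ (f₂ * f₃) γ T hT hT', Finset.sum_comm]
    refine Finset.sum_congr rfl fun d hd => ?_
    rw [mul_apply, hT d hd, Finset.mul_sum]
  rw [hR, mul_apply]
  refine Finset.sum_congr rfl fun c hc => ?_
  have hsc : src γ = src c := (hDs c hc).symm
  rw [mul_apply, src_div hsc, Finset.sum_mul]
  have hinj : Set.InjOn (fun b => tmul b c) (fib f₂ (rng c) : Set 𝒢) := by
    intro b hb b' hb' h
    have h1 := congrArg (fun d => div d c) h
    simpa only [tmul_div (mem_fib.1 hb).1, tmul_div (mem_fib.1 hb').1] using h1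
  have hsub : (fib f₂ (rng c)).image (fun b => tmul b c) ⊆ T :=
    Finset.subset_biUnion_of_mem (fun c => (fib f₂ (rng c)).image fun b => tmul b c) hc
  rw [← Finset.sum_subset hsub, Finset.sum_image hinj]
  · refine Finset.sum_congr rfl fun b hb => ?_
    have hb1 := (mem_fib.1 hb).1
    rw [div_tmul_eq hb1 hsc, tmul_div hb1, _root_.mul_assoc]
  · intro d hd hn
    have hs : src d = src c := (hT d hd).trans hsc
    have h0 : f₂ (div d c) = 0 := by
      by_contra h
      exact hn (Finset.mem_image.2 ⟨div d c, mem_fib.2 ⟨src_div hs, h⟩, div_tmul hs⟩)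
    rw [h0, zero_mul, mul_zero]

noncomputable instance : Ring (ConvAlg 𝒢) :=
  { (inferInstance : AddCommGroup (ConvAlg 𝒢)) with
    mul_assoc := mul_assoc'
    one_mul := one_mul'
    mul_one := mul_one'
    left_distrib := mul_add'
    right_distrib := add_mul'
    zero_mul := fun f => by simpa using smul_mul' 0 0 f
    mul_zero := fun f => by simpa using mul_smul' 0 f 0 }

noncomputable instance : Algebra ℂ (ConvAlg 𝒢) := Algebra.ofModule smul_mul' mul_smul'

end ConvAlg

end Basic

section Topological

variable {𝒢 Ω : Type*} [ArrowGroupoid 𝒢 Ω] [TopologicalSpace 𝒢] [TopologicalSpace Ω]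

/-- A bisection: a set of arrows on which the source and the range maps are homeomorphisms
onto their images. -/
def IsBisection (A : Set 𝒢) : Prop :=
  Topology.IsEmbedding (fun a : A => src a.1) ∧ Topology.IsEmbedding (fun a : A => rng a.1)

variable (𝒢) in
/-- The algebra `ℂ𝒢` of an ample groupoid: the algebra generated, under convolution, by the
indicator functions of the compact open bisections. -/
noncomputable def groupoidAlgebra : Subalgebra ℂ (ConvAlg 𝒢) :=
  Algebra.adjoin ℂ {f | ∃ F : Set 𝒢, IsCompact F ∧ IsOpen F ∧ IsBisection F ∧
    (f : 𝒢 → ℂ) = F.indicator 1}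

/-- The strict support `{γ | f γ ≠ 0}` of `f` has empty interior. -/
def IsEssentiallyZero (f : 𝒢 → ℂ) : Prop := interior {γ | f γ ≠ 0} = ∅

/-- Topological properties of étale groupoids that make the essential ideal an ideal. -/
class HasOpenProducts (𝒢 : Type*) {Ω : outParam Type*} [ArrowGroupoid 𝒢 Ω]
    [TopologicalSpace 𝒢] :
    Prop where
  isOpen_range_unit : IsOpen (Set.range (unit : Ω → 𝒢))
  isOpen_image_inv : ∀ U : Set 𝒢, IsOpen U → IsOpen (inv '' U)
  isOpen_product : ∀ U V : Set 𝒢, IsOpen U → IsOpen V →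
    IsOpen {c : 𝒢 | ∃ a ∈ U, ∃ b ∈ V, ∃ h : src a = rng b, mul a b h = c}

theorem isOpen_product' [HasOpenProducts 𝒢] {U V : Set 𝒢} (hU : IsOpen U) (hV : IsOpen V) :
    IsOpen {c : 𝒢 | ∃ a ∈ U, ∃ b ∈ V, src a = rng b ∧ tmul a b = c} := by
  have h := HasOpenProducts.isOpen_product U V hU hV
  convert h using 1
  ext c
  constructor
  · rintro ⟨a, ha, b, hb, h, rfl⟩; exact ⟨a, ha, b, hb, h, (tmul_eq h).symm⟩
  · rintro ⟨a, ha, b, hb, h, rfl⟩; exact ⟨a, ha, b, hb, h, tmul_eq h⟩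

/-- `f` is locally constant on a dense open set. -/
def DenselyConstant (f : 𝒢 → ℂ) : Prop :=
  ∀ W : Set 𝒢, IsOpen W → W.Nonempty →
    ∃ V ⊆ W, IsOpen V ∧ V.Nonempty ∧ ∃ c : ℂ, ∀ γ ∈ V, f γ = c

theorem isEssentiallyZero_iff {f : 𝒢 → ℂ} : IsEssentiallyZero f ↔
    ∀ W : Set 𝒢, IsOpen W → W.Nonempty → ∃ γ ∈ W, f γ = 0 := by
  unfold IsEssentiallyZero
  rw [interior_eq_empty_iff_dense_compl, dense_iff_inter_open]
  refine forall_congr' fun W => forall_congr' fun _ => forall_congr' fun _ => ?_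
  constructor
  · rintro ⟨γ, h1, h2⟩; exact ⟨γ, h1, not_not.1 h2⟩
  · rintro ⟨γ, h1, h2⟩; exact ⟨γ, h1, not_not.2 h2⟩


section Indicator

variable {F : Set 𝒢} {g : ConvAlg 𝒢}

theorem indicator_mul_apply (hF : Set.InjOn rng F) (hg : (g : 𝒢 → ℂ) = F.indicator 1)
    (f : ConvAlg 𝒢) {γ a : 𝒢} (ha : a ∈ F) (h : rng a = rng γ) :
    (g * f) γ = f (tmul (inv a) γ) := by
  classical
  have hc : src (inv a) = rng γ := (src_inv a).trans h
  have hs : src (tmul (inv a) γ) = src γ := src_tmul hc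
  rw [ConvAlg.mul_apply_of g f γ (insert (tmul (inv a) γ) (ConvAlg.fib f (src γ)))]
  · rw [Finset.sum_eq_single (tmul (inv a) γ)]
    · have h1 : div γ (tmul (inv a) γ) = a := by
        have h2 := tmul_div (a := a) (b := tmul (inv a) γ) (by rw [rng_tmul hc, rng_inv])
        rwa [tmul_inv_tmul' h] at h2
      rw [h1, hg, Set.indicator_of_mem ha]; simp
    · intro b hb hne
      have hb' : src γ = src b := by
        rcases Finset.mem_insert.1 hb with rfl | hb
        · exact hs.symm
        · exact ((ConvAlg.mem_fib.1 hb).1).symm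
      rw [hg, Set.indicator_of_notMem, zero_mul]
      intro hm
      have h1 : div γ b = a := hF hm ha ((rng_div hb').trans h.symm)
      apply hne
      have h2 := div_tmul hb'
      rw [h1] at h2
      rw [← h2, inv_tmul_cancel]
      rw [← h1, src_div hb']
    · intro hn; exact absurd (Finset.mem_insert_self _ _) hn
  · intro b hb
    rcases Finset.mem_insert.1 hb with rfl | hb
    · exact hs
    · exact (ConvAlg.mem_fib.1 hb).1
  · exact fun b hb h' => Finset.mem_insert_of_mem (ConvAlg.mem_fib.2 ⟨hb, h'⟩)

theorem indicator_mul_apply_zero (hg : (g : 𝒢 → ℂ) = F.indicator 1)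
    (f : ConvAlg 𝒢) {γ : 𝒢} (h : ∀ a ∈ F, rng a ≠ rng γ) : (g * f) γ = 0 := by
  rw [ConvAlg.mul_apply]
  refine Finset.sum_eq_zero fun b hb => ?_
  have hb' : src γ = src b := ((ConvAlg.mem_fib.1 hb).1).symm
  rw [hg, Set.indicator_of_notMem, zero_mul]
  exact fun hm => h _ hm (rng_div hb')

theorem mul_indicator_apply (hF : Set.InjOn src F) (hg : (g : 𝒢 → ℂ) = F.indicator 1)
    (f : ConvAlg 𝒢) {γ a : 𝒢} (ha : a ∈ F) (h : src a = src γ) :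
    (f * g) γ = f (div γ a) := by
  rw [ConvAlg.mul_apply_of f g γ {a}]
  · rw [Finset.sum_singleton, hg, Set.indicator_of_mem ha]; simp
  · intro b hb; rw [Finset.mem_singleton.1 hb, h]
  · intro b hb h'
    rw [hg] at h'
    exact Finset.mem_singleton.2 (hF (Set.mem_of_indicator_ne_zero h') ha (hb.trans h.symm))

theorem mul_indicator_apply_zero (hg : (g : 𝒢 → ℂ) = F.indicator 1)
    (f : ConvAlg 𝒢) {γ : 𝒢} (h : ∀ a ∈ F, src a ≠ src γ) : (f * g) γ = 0 := by
  rw [ConvAlg.mul_apply_of f g γ ∅ (by simp), Finset.sum_empty]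
  intro b hb h'
  rw [hg] at h'
  exact absurd hb (h b (Set.mem_of_indicator_ne_zero h'))

variable [HasOpenProducts 𝒢]

/-- The set `F⁻¹ W`. -/
theorem isOpen_inv_product {W : Set 𝒢} (hFo : IsOpen F) (hW : IsOpen W) :
    IsOpen {c : 𝒢 | ∃ a ∈ F, ∃ b ∈ W, rng a = rng b ∧ tmul (inv a) b = c} := by
  have h := isOpen_product' (HasOpenProducts.isOpen_image_inv F hFo) hW
  convert h using 1
  ext c
  constructor
  · rintro ⟨a, ha, b, hb, h, rfl⟩
    exact ⟨inv a, ⟨a, ha, rfl⟩, b, hb, by rw [src_inv, h], rfl⟩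
  · rintro ⟨_, ⟨a, ha, rfl⟩, b, hb, h, rfl⟩
    exact ⟨a, ha, b, hb, by rw [← src_inv, h], rfl⟩

/-- The set `W F⁻¹`. -/
theorem isOpen_product_inv {W : Set 𝒢} (hFo : IsOpen F) (hW : IsOpen W) :
    IsOpen {c : 𝒢 | ∃ a ∈ F, ∃ b ∈ W, src a = src b ∧ div b a = c} := by
  have h := isOpen_product' hW (HasOpenProducts.isOpen_image_inv F hFo)
  convert h using 1
  ext c
  constructor
  · rintro ⟨a, ha, b, hb, h, rfl⟩
    exact ⟨b, hb, inv a, ⟨a, ha, rfl⟩, by rw [rng_inv, h], rfl⟩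
  · rintro ⟨b, hb, _, ⟨a, ha, rfl⟩, h, rfl⟩
    exact ⟨a, ha, b, hb, by rw [h, rng_inv], rfl⟩

theorem DenselyConstant.indicator_mul {f : ConvAlg 𝒢} (hf : DenselyConstant f) (hFo : IsOpen F)
    (hF : Set.InjOn rng F) (hg : (g : 𝒢 → ℂ) = F.indicator 1) :
    DenselyConstant (g * f : ConvAlg 𝒢) := by
  intro W hW hne
  by_cases h : ∃ γ ∈ W, ∃ a ∈ F, rng a = rng γ
  · obtain ⟨γ, hγ, a, ha, har⟩ := h
    obtain ⟨V, hVs, hVo, ⟨δ, hδ⟩, c, hc⟩ := hf _ (isOpen_inv_product hFo hW)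
      ⟨_, a, ha, γ, hγ, har, rfl⟩
    refine ⟨_, Set.inter_subset_right, (isOpen_product' hFo hVo).inter hW, ?_, c, ?_⟩
    · obtain ⟨a, ha, b, hb, hab, rfl⟩ := hVs hδ
      refine ⟨b, ⟨a, ha, tmul (inv a) b, hδ, ?_, tmul_inv_tmul' hab⟩, hb⟩
      rw [rng_tmul ((src_inv a).trans hab), rng_inv]
    · rintro _ ⟨⟨a, ha, b, hb, hab, rfl⟩, -⟩
      rw [indicator_mul_apply hF hg f ha (rng_tmul hab).symm, inv_tmul_cancel hab, hc b hb]
  · refine ⟨W, subset_rfl, hW, hne, 0, fun γ hγ => indicator_mul_apply_zero hg f ?_⟩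
    exact fun a ha h' => h ⟨γ, hγ, a, ha, h'⟩

theorem IsEssentiallyZero.indicator_mul {f : ConvAlg 𝒢} (hf : IsEssentiallyZero (f : 𝒢 → ℂ))
    (hFo : IsOpen F) (hF : Set.InjOn rng F) (hg : (g : 𝒢 → ℂ) = F.indicator 1) :
    IsEssentiallyZero ((g * f : ConvAlg 𝒢) : 𝒢 → ℂ) := by
  rw [isEssentiallyZero_iff] at hf ⊢
  intro W hW hne
  by_cases h : ∃ γ ∈ W, ∃ a ∈ F, rng a = rng γ
  · obtain ⟨γ, hγ, a, ha, har⟩ := h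
    obtain ⟨_, ⟨a, ha, b, hb, hab, rfl⟩, h0⟩ := hf _ (isOpen_inv_product hFo hW)
      ⟨_, a, ha, γ, hγ, har, rfl⟩
    exact ⟨b, hb, by rw [indicator_mul_apply hF hg f ha hab, h0]⟩
  · obtain ⟨γ, hγ⟩ := hne
    exact ⟨γ, hγ, indicator_mul_apply_zero hg f fun a ha h' => h ⟨γ, hγ, a, ha, h'⟩⟩

theorem IsEssentiallyZero.mul_indicator {f : ConvAlg 𝒢} (hf : IsEssentiallyZero (f : 𝒢 → ℂ))
    (hFo : IsOpen F) (hF : Set.InjOn src F) (hg : (g : 𝒢 → ℂ) = F.indicator 1) :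
    IsEssentiallyZero ((f * g : ConvAlg 𝒢) : 𝒢 → ℂ) := by
  rw [isEssentiallyZero_iff] at hf ⊢
  intro W hW hne
  by_cases h : ∃ γ ∈ W, ∃ a ∈ F, src a = src γ
  · obtain ⟨γ, hγ, a, ha, har⟩ := h
    obtain ⟨_, ⟨a, ha, b, hb, hab, rfl⟩, h0⟩ := hf _ (isOpen_product_inv hFo hW)
      ⟨_, a, ha, γ, hγ, har, rfl⟩
    exact ⟨b, hb, by rw [mul_indicator_apply hF hg f ha hab, h0]⟩
  · obtain ⟨γ, hγ⟩ := hne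
    exact ⟨γ, hγ, mul_indicator_apply_zero hg f fun a ha h' => h ⟨γ, hγ, a, ha, h'⟩⟩

end Indicator

theorem IsBisection.injOn_src {F : Set 𝒢} (h : IsBisection F) : Set.InjOn src F :=
  Set.injOn_iff_injective.2 h.1.injective

theorem IsBisection.injOn_rng {F : Set 𝒢} (h : IsBisection F) : Set.InjOn rng F :=
  Set.injOn_iff_injective.2 h.2.injective

theorem DenselyConstant.add {f g : ConvAlg 𝒢} (hf : DenselyConstant f) (hg : DenselyConstant g) :
    DenselyConstant (f + g : ConvAlg 𝒢) := by
  intro W hW hne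
  obtain ⟨V, hVs, hVo, hVn, c, hc⟩ := hf W hW hne
  obtain ⟨V', hVs', hVo', hVn', c', hc'⟩ := hg V hVo hVn
  exact ⟨V', hVs'.trans hVs, hVo', hVn', c + c', fun γ hγ => by
    rw [ConvAlg.add_apply, hc γ (hVs' hγ), hc' γ hγ]⟩

theorem DenselyConstant.smul {f : ConvAlg 𝒢} (hf : DenselyConstant f) (r : ℂ) :
    DenselyConstant (r • f : ConvAlg 𝒢) := by
  intro W hW hne
  obtain ⟨V, hVs, hVo, hVn, c, hc⟩ := hf W hW hne
  exact ⟨V, hVs, hVo, hVn, r * c, fun γ hγ => by rw [ConvAlg.smul_apply, hc γ hγ]⟩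

theorem IsEssentiallyZero.smul {f : ConvAlg 𝒢} (hf : IsEssentiallyZero (f : 𝒢 → ℂ)) (r : ℂ) :
    IsEssentiallyZero ((r • f : ConvAlg 𝒢) : 𝒢 → ℂ) := by
  rw [isEssentiallyZero_iff] at hf ⊢
  intro W hW hne
  obtain ⟨γ, hγ, h0⟩ := hf W hW hne
  exact ⟨γ, hγ, by rw [ConvAlg.smul_apply, h0, mul_zero]⟩

theorem IsEssentiallyZero.add {f g : ConvAlg 𝒢} (hf : IsEssentiallyZero (f : 𝒢 → ℂ))
    (hg : IsEssentiallyZero (g : 𝒢 → ℂ)) (hfc : DenselyConstant f) :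
    IsEssentiallyZero ((f + g : ConvAlg 𝒢) : 𝒢 → ℂ) := by
  rw [isEssentiallyZero_iff] at hf hg ⊢
  intro W hW hne
  obtain ⟨V, hVs, hVo, hVn, c, hc⟩ := hfc W hW hne
  obtain ⟨γ, hγ, h0⟩ := hf V hVo hVn
  obtain ⟨δ, hδ, h0'⟩ := hg V hVo hVn
  refine ⟨δ, hVs hδ, ?_⟩
  rw [ConvAlg.add_apply, h0', hc δ hδ, ← hc γ hγ, h0, add_zero]

variable [HasOpenProducts 𝒢]

theorem denselyConstant_one : DenselyConstant (1 : ConvAlg 𝒢) := by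
  intro W hW hne
  by_cases h : (W ∩ Set.range (unit : Ω → 𝒢)).Nonempty
  · refine ⟨_, Set.inter_subset_left, hW.inter HasOpenProducts.isOpen_range_unit, h, 1, ?_⟩
    intro γ hγ
    rw [ConvAlg.one_apply, Set.indicator_of_mem hγ.2]; rfl
  · refine ⟨W, subset_rfl, hW, hne, 0, fun γ hγ => ?_⟩
    rw [ConvAlg.one_apply, Set.indicator_of_notMem fun h' => h ⟨γ, hγ, h'⟩]

theorem denselyConstant_of_mem {f : ConvAlg 𝒢} (hf : f ∈ groupoidAlgebra 𝒢) :
    DenselyConstant f := by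
  suffices h : ∀ g : ConvAlg 𝒢, DenselyConstant g → DenselyConstant (f * g : ConvAlg 𝒢) by
    simpa using h 1 denselyConstant_one
  induction hf using Algebra.adjoin_induction with
  | mem f hf =>
    obtain ⟨F, -, hFo, hFb, hf⟩ := hf
    exact fun g hg => hg.indicator_mul hFo hFb.injOn_rng hf
  | algebraMap r =>
    intro g hg
    rw [← Algebra.smul_def]
    exact hg.smul r
  | add f₁ f₂ _ _ h₁ h₂ =>
    intro g hg
    rw [add_mul]
    exact (h₁ g hg).add (h₂ g hg)
  | mul f₁ f₂ _ _ h₁ h₂ =>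
    intro g hg
    rw [_root_.mul_assoc]
    exact h₁ _ (h₂ g hg)

theorem IsEssentiallyZero.mul_left {f g : ConvAlg 𝒢} (hf : f ∈ groupoidAlgebra 𝒢)
    (hg : g ∈ groupoidAlgebra 𝒢) (h : IsEssentiallyZero (g : 𝒢 → ℂ)) :
    IsEssentiallyZero ((f * g : ConvAlg 𝒢) : 𝒢 → ℂ) := by
  induction hf using Algebra.adjoin_induction generalizing g with
  | mem f hf =>
    obtain ⟨F, -, hFo, hFb, hf⟩ := hf
    exact h.indicator_mul hFo hFb.injOn_rng hf
  | algebraMap r =>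
    rw [← Algebra.smul_def]
    exact h.smul r
  | add f₁ f₂ hf₁ hf₂ h₁ h₂ =>
    rw [add_mul]
    exact (h₁ hg h).add (h₂ hg h) (denselyConstant_of_mem (mul_mem hf₁ hg))
  | mul f₁ f₂ hf₁ hf₂ h₁ h₂ =>
    rw [_root_.mul_assoc]
    exact h₁ (mul_mem hf₂ hg) (h₂ hg h)

theorem IsEssentiallyZero.mul_right {f g : ConvAlg 𝒢} (hf : f ∈ groupoidAlgebra 𝒢)
    (hg : g ∈ groupoidAlgebra 𝒢) (h : IsEssentiallyZero (g : 𝒢 → ℂ)) :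
    IsEssentiallyZero ((g * f : ConvAlg 𝒢) : 𝒢 → ℂ) := by
  induction hf using Algebra.adjoin_induction generalizing g with
  | mem f hf =>
    obtain ⟨F, -, hFo, hFb, hf⟩ := hf
    exact h.mul_indicator hFo hFb.injOn_src hf
  | algebraMap r =>
    rw [← Algebra.commutes, ← Algebra.smul_def]
    exact h.smul r
  | add f₁ f₂ hf₁ hf₂ h₁ h₂ =>
    rw [mul_add]
    exact (h₁ hg h).add (h₂ hg h) (denselyConstant_of_mem (mul_mem hg hf₁))
  | mul f₁ f₂ hf₁ hf₂ h₁ h₂ =>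
    rw [← _root_.mul_assoc]
    exact h₂ (mul_mem hg hf₁) (h₁ hg h)

variable (𝒢) in
/-- The algebraic essential ideal of `ℂ𝒢`: the elements of `ℂ𝒢` whose strict support has empty
interior in `𝒢`. -/
noncomputable def essentialIdeal : TwoSidedIdeal (groupoidAlgebra 𝒢) :=
  TwoSidedIdeal.mk' {f | IsEssentiallyZero (f.1 : 𝒢 → ℂ)}
    (by simp [IsEssentiallyZero])
    (fun {f g} hf hg => hf.add hg (denselyConstant_of_mem f.2))
    (fun {f} hf => by
      have h := IsEssentiallyZero.smul hf (-1)
      rw [neg_one_smul] at h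
      exact h)
    (fun {f g} hg => IsEssentiallyZero.mul_left f.2 g.2 hg)
    (fun {f g} hf => IsEssentiallyZero.mul_right g.2 f.2 hf)

theorem mem_essentialIdeal (f : groupoidAlgebra 𝒢) :
    f ∈ essentialIdeal 𝒢 ↔ interior {γ : 𝒢 | f.1 γ ≠ 0} = ∅ :=
  TwoSidedIdeal.mem_mk' _ _ _ _ _ _ f

end Topological

end ArrowGroupoid

/-! ## Groupoids of germs of inverse semigroup actions -/

/-- An inverse monoid, given by its multiplication and its involution `s ↦ s*`. -/
class IsInverseMonoid (S : Type*) [Monoid S] [StarMul S] : Prop where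
  mul_star_mul : ∀ s : S, s * star s * s = s
  idem_comm : ∀ e f : S, IsIdempotentElem e → IsIdempotentElem f → e * f = f * e

/-- The monoid of partial bijections of a set, with `(f * g) x = f (g x)`. -/
def PartialPerm (Ω : Type*) : Type _ := Ω ≃. Ω

namespace PartialPerm

variable {Ω : Type*}

instance : FunLike (PartialPerm Ω) Ω (Option Ω) := inferInstanceAs (FunLike (Ω ≃. Ω) Ω (Option Ω))

theorem ext {f g : PartialPerm Ω} (h : ∀ x, f x = g x) : f = g := DFunLike.ext _ _ h

instance : MonoidWithZero (PartialPerm Ω) where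
  mul f g := PEquiv.trans g f
  one := PEquiv.refl Ω
  zero := (⊥ : Ω ≃. Ω)
  mul_assoc f g h := (PEquiv.trans_assoc h g f).symm
  one_mul f := PEquiv.trans_refl f
  mul_one f := PEquiv.refl_trans f
  zero_mul f := PEquiv.trans_bot f
  mul_zero f := PEquiv.bot_trans f

instance : StarMul (PartialPerm Ω) where
  star f := PEquiv.symm f
  star_involutive _ := rfl
  star_mul f g := PEquiv.symm_trans_rev g f

theorem mul_eq_some {f g : PartialPerm Ω} {x z : Ω} :
    (f * g) x = some z ↔ ∃ y, g x = some y ∧ f y = some z :=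
  PEquiv.trans_eq_some g f x z

theorem one_apply (x : Ω) : (1 : PartialPerm Ω) x = some x := rfl

theorem zero_apply (x : Ω) : (0 : PartialPerm Ω) x = none := rfl

theorem star_eq_some {f : PartialPerm Ω} {x y : Ω} : star f y = some x ↔ f x = some y :=
  PEquiv.eq_some_iff f

theorem inj {f : PartialPerm Ω} {x x' y : Ω} (h : f x = some y) (h' : f x' = some y) : x = x' :=
  PEquiv.inj f h h'

end PartialPerm

/-- An action of an inverse monoid on a topological space by partial homeomorphisms between
open subsets: a homomorphism `act` to the partial bijections, for which the preimages of open sets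
(in particular the domains) are open. -/
class PartialAction (S : Type*) (Ω : outParam Type*) [Monoid S] [StarMul S]
    [TopologicalSpace Ω] where
  act : S →* PartialPerm Ω
  act_star : ∀ s, act (star s) = star (act s)
  isOpen_preimage : ∀ (s : S) (U : Set Ω), IsOpen U → IsOpen {x | ∃ y ∈ U, act s x = some y}

namespace PartialAction

variable {S Ω : Type*} [Monoid S] [StarMul S] [TopologicalSpace Ω] [PartialAction S Ω]

theorem act_mul_eq_some {s t : S} {x z : Ω} :
    act (s * t) x = some z ↔ ∃ y, act t x = some y ∧ act s y = some z := by
  rw [map_mul, PartialPerm.mul_eq_some]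

theorem act_star_eq_some {s : S} {x y : Ω} : act (star s) y = some x ↔ act s x = some y := by
  rw [act_star, PartialPerm.star_eq_some]

theorem act_idem {e : S} (he : IsIdempotentElem e) {x y : Ω} (h : act e x = some y) : y = x := by
  rw [← he.eq, act_mul_eq_some] at h
  obtain ⟨z, h1, h2⟩ := h
  have h3 : act e x = some y := by rw [← he.eq, act_mul_eq_some]; exact ⟨z, h1, h2⟩
  have : z = y := by rw [h1] at h3; exact Option.some.inj h3
  subst this
  exact PartialPerm.inj h2 h1

end PartialAction

namespace IsInverseMonoid

variable {S : Type*} [Monoid S] [StarMul S] [IsInverseMonoid S]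

theorem idem_star_mul (s : S) : IsIdempotentElem (star s * s) := by
  change star s * s * (star s * s) = star s * s
  rw [mul_assoc, ← mul_assoc s, mul_star_mul]

theorem idem_mul_star (s : S) : IsIdempotentElem (s * star s) := by
  simpa using idem_star_mul (star s)

theorem idem_mul {e f : S} (he : IsIdempotentElem e) (hf : IsIdempotentElem f) :
    IsIdempotentElem (e * f) := by
  change e * f * (e * f) = e * f
  rw [mul_assoc, ← mul_assoc f, idem_comm f e hf he, mul_assoc e f f, hf.eq, ← mul_assoc, he.eq]

theorem star_idem {e : S} (he : IsIdempotentElem e) : star e = e := by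
  have he' : IsIdempotentElem (star e) := by
    change star e * star e = star e
    rw [← star_mul, he.eq]
  have h1 : e = star e * e := by
    conv_lhs => rw [← mul_star_mul e, idem_comm e (star e) he he', mul_assoc, he.eq]
  have h2 := congrArg star h1
  rw [star_mul, star_star, ← h1] at h2
  exact h2

theorem idem_conj {e : S} (he : IsIdempotentElem e) (t : S) :
    IsIdempotentElem (star t * e * t) := by
  have h : star t * e * t = star (e * t) * (e * t) := by
    rw [star_mul, star_idem he, mul_assoc, mul_assoc, ← mul_assoc e e, he.eq]
  rw [h]
  exact idem_star_mul _

theorem mul_conj {e : S} (he : IsIdempotentElem e) (t : S) : t * (star t * e * t) = e * t := by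
  rw [← mul_assoc, ← mul_assoc, idem_comm _ e (idem_mul_star t) he, mul_assoc, mul_star_mul]

end IsInverseMonoid

section Germs

open PartialAction IsInverseMonoid

variable (S : Type*) {Ω : Type*} [Monoid S] [StarMul S] [IsInverseMonoid S] [TopologicalSpace Ω]
  [PartialAction S Ω]

/-- A pair `(s, x)` with `x` in the domain of `s`; `img` is the value `s x`. -/
structure PreGerm where
  elt : S
  pt : Ω
  img : Ω
  act_eq : act elt pt = some img

variable {S}

/-- Two pairs `(s, x)` and `(t, x)` have the same germ if `s e = t e` for some idempotent `e`
whose domain contains `x`. -/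
def PreGerm.Equiv (a b : PreGerm S) : Prop :=
  a.pt = b.pt ∧ ∃ e : S, IsIdempotentElem e ∧ act e a.pt = some a.pt ∧ a.elt * e = b.elt * e

variable (S) in
instance germSetoid : Setoid (PreGerm S) where
  r := PreGerm.Equiv
  iseqv := by
    refine ⟨fun a => ⟨rfl, 1, IsIdempotentElem.one, by rw [map_one]; rfl, rfl⟩, ?_, ?_⟩
    · rintro a b ⟨h, e, he, hx, heq⟩
      exact ⟨h.symm, e, he, h ▸ hx, heq.symm⟩
    · rintro a b c ⟨h, e, he, hx, heq⟩ ⟨h', f, hf, hx', heq'⟩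
      refine ⟨h.trans h', e * f, idem_mul he hf, ?_, ?_⟩
      · rw [act_mul_eq_some]
        exact ⟨a.pt, by rw [h]; exact hx', hx⟩
      · rw [← mul_assoc, heq, idem_comm e f he hf, ← mul_assoc, ← heq', mul_assoc, mul_assoc,
          idem_comm e f he hf]

variable (S) in
/-- The set of germs of the action. -/
def Germ : Type _ := Quotient (germSetoid S)

namespace Germ

/-- The germ of `s` at `x`, where `s x = y`. -/
def mk (s : S) (x y : Ω) (h : act s x = some y) : Germ S := Quotient.mk _ ⟨s, x, y, h⟩

theorem ind {p : Germ S → Prop} (h : ∀ s x y hs, p (mk s x y hs)) (γ : Germ S) : p γ :=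
  Quotient.ind (fun a => h a.elt a.pt a.img a.act_eq) γ

theorem mk_eq_mk {s t : S} {x x' y y' : Ω} {h : act s x = some y} {h' : act t x' = some y'} :
    mk s x y h = mk t x' y' h' ↔
      x = x' ∧ ∃ e : S, IsIdempotentElem e ∧ act e x = some x ∧ s * e = t * e :=
  Quotient.eq

theorem mk_congr {s t : S} {x y : Ω} {h : act s x = some y} {h' : act t x = some y} (hst : s = t) :
    mk s x y h = mk t x y h' := by subst hst; rfl

/-- The source of the germ of `s` at `x` is `x`. -/
def src : Germ S → Ω := Quotient.lift PreGerm.pt fun _ _ h => h.1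

/-- The range of the germ of `s` at `x` is `s x`. -/
def rng : Germ S → Ω := Quotient.lift PreGerm.img <| by
  rintro ⟨s, x, y, hs⟩ ⟨t, x', y', ht⟩ ⟨h, e, he, hx, heq⟩
  dsimp only at h hx heq ⊢
  subst h
  have h1 : act (s * e) x = some y := by rw [act_mul_eq_some]; exact ⟨x, hx, hs⟩
  have h2 : act (t * e) x = some y' := by rw [act_mul_eq_some]; exact ⟨x, hx, ht⟩
  rw [heq, h2] at h1
  exact (Option.some.inj h1).symm

theorem src_mk {s : S} {x y : Ω} (h : act s x = some y) : src (mk s x y h) = x := rfl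

theorem rng_mk {s : S} {x y : Ω} (h : act s x = some y) : rng (mk s x y h) = y := rfl

theorem mul_wd {s s' t t' : S} {x y z : Ω} {hs : act s y = some z} {hs' : act s' y = some z}
    {ht : act t x = some y} {ht' : act t' x = some y} (h : mk s y z hs = mk s' y z hs')
    (h' : mk t x y ht = mk t' x y ht') :
    mk (s * t) x z (act_mul_eq_some.2 ⟨y, ht, hs⟩) =
      mk (s' * t') x z (act_mul_eq_some.2 ⟨y, ht', hs'⟩) := by
  obtain ⟨-, e, he, hy, hse⟩ := mk_eq_mk.1 h
  obtain ⟨-, f, hf, hx, htf⟩ := mk_eq_mk.1 h'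
  have hk := idem_conj he t
  refine mk_eq_mk.2 ⟨rfl, (star t * e * t) * f, idem_mul hk hf, ?_, ?_⟩
  · refine act_mul_eq_some.2 ⟨x, hx, act_mul_eq_some.2 ⟨y, ht, act_mul_eq_some.2 ⟨y, hy, ?_⟩⟩⟩
    exact act_star_eq_some.2 ht
  · have e1 : s * t * (star t * e * t * f) = s * e * t * f := by
      rw [mul_assoc s t, ← mul_assoc t, mul_conj he, ← mul_assoc, ← mul_assoc]
    have e2 : s' * t' * (star t * e * t * f) = s' * e * t * f := by
      rw [idem_comm _ f hk hf, ← mul_assoc, mul_assoc s', ← htf, mul_assoc s', mul_assoc t,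
        idem_comm f _ hf hk, ← mul_assoc t, mul_conj he, ← mul_assoc, ← mul_assoc]
    rw [e1, e2, hse]

theorem exists_rep (γ : Germ S) : ∃ s, ∃ h : act s (src γ) = some (rng γ), γ = mk s _ _ h := by
  induction γ using ind with
  | h s x y hs => exact ⟨s, hs, rfl⟩

/-- An element of `S` representing a germ. -/
noncomputable def rep (γ : Germ S) : S := (exists_rep γ).choose

theorem rep_spec (γ : Germ S) : act (rep γ) (src γ) = some (rng γ) := (exists_rep γ).choose_spec.choose

theorem mk_rep (γ : Germ S) : mk (rep γ) _ _ (rep_spec γ) = γ :=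
  (exists_rep γ).choose_spec.choose_spec.symm

/-- The product of germs: `[s, t x] [t, x] = [s t, x]`. -/
noncomputable def mul (a b : Germ S) (h : src a = rng b) : Germ S :=
  mk (rep a * rep b) (src b) (rng a)
    (act_mul_eq_some.2 ⟨rng b, rep_spec b, by rw [← h]; exact rep_spec a⟩)

theorem mul_mk {s t : S} {x y z : Ω} (hs : act s y = some z) (ht : act t x = some y) :
    mul (mk s y z hs) (mk t x y ht) rfl = mk (s * t) x z (act_mul_eq_some.2 ⟨y, ht, hs⟩) :=
  mul_wd (mk_rep (mk s y z hs)) (mk_rep (mk t x y ht))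

/-- The inverse of a germ: `[s, x]⁻¹ = [s*, s x]`. -/
noncomputable def inv (a : Germ S) : Germ S :=
  mk (star (rep a)) (rng a) (src a) (act_star_eq_some.2 (rep_spec a))

theorem inv_mk {s : S} {x y : Ω} (hs : act s x = some y) :
    inv (mk s x y hs) = mk (star s) y x (act_star_eq_some.2 hs) := by
  have h := mk_rep (mk s x y hs)
  unfold inv
  generalize_proofs h1 h2 at h ⊢
  revert h1 h2
  generalize rep (mk s x y hs) = t
  rw [src_mk, rng_mk]
  intro h1 h2 h3
  obtain ⟨-, e, he, hx, heq⟩ := mk_eq_mk.1 h2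
  refine mk_eq_mk.2 ⟨rfl, t * e * star t, ?_, ?_, ?_⟩
  · simpa using idem_conj he (star t)
  · exact act_mul_eq_some.2 ⟨x, h3, act_mul_eq_some.2 ⟨x, hx, h1⟩⟩
  · have key : ∀ r : S, star r * (r * e * star r) = e * star r := by
      intro r
      have := mul_conj he (star r)
      rwa [star_star] at this
    have e1 : t * e * star t = s * e * star s := by
      have : ∀ r : S, r * e * star r = (r * e) * star (r * e) := by
        intro r
        rw [star_mul, star_idem he, ← mul_assoc, mul_assoc r e e, he.eq]
      rw [this, this, heq]
    rw [key, e1, key]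
    have h4 := congrArg star heq
    rwa [star_mul, star_mul, star_idem he] at h4

end Germ

noncomputable instance : ArrowGroupoid (Germ S) Ω where
  src := Germ.src
  rng := Germ.rng
  unit x := Germ.mk 1 x x (by rw [map_one]; rfl)
  mul := Germ.mul
  inv := Germ.inv
  src_unit _ := rfl
  rng_unit _ := rfl
  src_mul _ _ _ := rfl
  rng_mul _ _ _ := rfl
  src_inv _ := rfl
  rng_inv _ := rfl
  mul_unit a := by
    induction a using Germ.ind with
    | h s x y hs => exact (Germ.mul_mk _ _).trans (Germ.mk_congr (mul_one s))
  unit_mul a := by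
    induction a using Germ.ind with
    | h s x y hs => exact (Germ.mul_mk _ _).trans (Germ.mk_congr (one_mul s))
  mul_assoc a b c h₁ h₂ := by
    induction a using Germ.ind with
    | h s x y hs =>
    induction b using Germ.ind with
    | h t x' y' ht =>
    induction c using Germ.ind with
    | h r x'' y'' hr =>
    change x = y' at h₁
    change x' = y'' at h₂
    subst h₁ h₂
    simp only [Germ.mul_mk]
    exact Germ.mk_congr (mul_assoc s t r)
  mul_inv a := by
    induction a using Germ.ind with
    | h s x y hs =>
    simp only [Germ.inv_mk]
    refine (Germ.mul_mk _ _).trans (Germ.mk_eq_mk.2 ⟨rfl, s * star s, idem_mul_star s, ?_, ?_⟩)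
    · exact act_mul_eq_some.2 ⟨x, act_star_eq_some.2 hs, hs⟩
    · rw [one_mul, (idem_mul_star s).eq]
  inv_mul a := by
    induction a using Germ.ind with
    | h s x y hs =>
    simp only [Germ.inv_mk]
    refine (Germ.mul_mk _ _).trans (Germ.mk_eq_mk.2 ⟨rfl, star s * s, idem_star_mul s, ?_, ?_⟩)
    · exact act_mul_eq_some.2 ⟨y, hs, act_star_eq_some.2 hs⟩
    · rw [one_mul, (idem_star_mul s).eq]

namespace Germ

/-- The set of the germs of `s` at the points of `U`. -/
def slice (s : S) (U : Set Ω) : Set (Germ S) :=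
  {γ | ∃ x ∈ U, ∃ y, ∃ h : act s x = some y, γ = mk s x y h}

/-- The topology on the set of germs has the sets of germs of `s` at the points of `U` as a basis,
where `s ∈ S` and `U` is open. -/
instance : TopologicalSpace (Germ S) :=
  TopologicalSpace.generateFrom {W | ∃ (s : S) (U : Set Ω), IsOpen U ∧ W = slice s U}

theorem isOpen_slice (s : S) {U : Set Ω} (hU : IsOpen U) : IsOpen (slice s U) :=
  TopologicalSpace.isOpen_generateFrom_of_mem ⟨s, U, hU, rfl⟩

theorem mk_mem_slice {s : S} {x y : Ω} (h : act s x = some y) {U : Set Ω} (hx : x ∈ U) :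
    mk s x y h ∈ slice s U := ⟨x, hx, y, h, rfl⟩

theorem isOpen_dom (s : S) : IsOpen {x : Ω | ∃ y, act s x = some y} := by
  simpa using isOpen_preimage s Set.univ isOpen_univ

/-- The points of `dom s` where the germ of `s` lies in a slice form an open set. -/
theorem isOpen_setOf_mem_slice (s t : S) {U : Set Ω} (hU : IsOpen U) :
    IsOpen {x : Ω | ∃ y, ∃ h : act s x = some y, mk s x y h ∈ slice t U} := by
  rw [isOpen_iff_forall_mem_open]
  rintro x ⟨y, h, x', hx', y', h', heq⟩
  obtain ⟨rfl, e, he, hx, hst⟩ := mk_eq_mk.1 heq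
  refine ⟨U ∩ {z | ∃ y, act s z = some y} ∩ {z | ∃ y, act e z = some y} ∩
    {z | ∃ y, act t z = some y}, ?_, ((hU.inter (isOpen_dom s)).inter (isOpen_dom e)).inter
      (isOpen_dom t), ⟨⟨⟨hx', y, h⟩, x, hx⟩, y', h'⟩⟩
  rintro z ⟨⟨⟨hz, w, hw⟩, v, hv⟩, w', hw'⟩
  obtain rfl := act_idem he hv
  exact ⟨w, hw, v, hz, w', hw', mk_eq_mk.2 ⟨rfl, e, he, hv, hst⟩⟩

theorem isTopologicalBasis : TopologicalSpace.IsTopologicalBasis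
    {W : Set (Germ S) | ∃ (s : S) (U : Set Ω), IsOpen U ∧ W = slice s U} where
  exists_subset_inter := by
    rintro _ ⟨s, U, hU, rfl⟩ _ ⟨t, V, hV, rfl⟩ γ ⟨⟨x, hx, y, h, rfl⟩, hγ⟩
    refine ⟨_, ⟨s, _, hU.inter (isOpen_setOf_mem_slice s t hV), rfl⟩,
      mk_mem_slice h ⟨hx, y, h, hγ⟩, ?_⟩
    rintro _ ⟨x, ⟨hx, y, h, hm⟩, y', h', rfl⟩
    refine ⟨⟨x, hx, y', h', rfl⟩, ?_⟩
    obtain rfl : y = y' := Option.some.inj (h.symm.trans h')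
    exact hm
  sUnion_eq := by
    refine Set.eq_univ_of_forall fun γ => ?_
    induction γ using ind with
    | h s x y hs => exact ⟨_, ⟨s, Set.univ, isOpen_univ, rfl⟩, mk_mem_slice hs trivial⟩
  eq_generateFrom := rfl

theorem continuous_src : Continuous (ArrowGroupoid.src : Germ S → Ω) := by
  refine ⟨fun U hU => ?_⟩
  have : (ArrowGroupoid.src : Germ S → Ω) ⁻¹' U = ⋃ s : S, slice s U := by
    ext γ
    rw [Set.mem_iUnion]
    constructor
    · induction γ using ind with
      | h s x y hs => exact fun hx => ⟨s, x, hx, y, hs, rfl⟩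
    · rintro ⟨s, x, hx, y, hs, rfl⟩; exact hx
  rw [this]
  exact isOpen_iUnion fun s => isOpen_slice s hU

theorem image_inv_slice (s : S) (U : Set Ω) :
    ArrowGroupoid.inv '' (slice s U) = slice (star s) {y | ∃ x ∈ U, act (star s) y = some x} := by
  ext γ
  constructor
  · rintro ⟨_, ⟨x, hx, y, h, rfl⟩, rfl⟩
    exact ⟨y, ⟨x, hx, act_star_eq_some.2 h⟩, x, act_star_eq_some.2 h, inv_mk h⟩
  · rintro ⟨y, ⟨x, hx, h⟩, x', h', rfl⟩
    obtain rfl : x = x' := Option.some.inj (h.symm.trans h')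
    exact ⟨_, ⟨x, hx, y, act_star_eq_some.1 h, rfl⟩, inv_mk _⟩

theorem product_slice (s t : S) (U V : Set Ω) :
    {c : Germ S | ∃ a ∈ slice s U, ∃ b ∈ slice t V, ∃ h : ArrowGroupoid.src a = ArrowGroupoid.rng b,
      ArrowGroupoid.mul a b h = c} = slice (s * t) (V ∩ {x | ∃ y ∈ U, act t x = some y}) := by
  ext γ
  constructor
  · rintro ⟨_, ⟨y, hy, z, hs, rfl⟩, _, ⟨x, hx, y', ht, rfl⟩, h, rfl⟩
    obtain rfl : y = y' := h
    exact ⟨x, ⟨hx, y, hy, ht⟩, z, _, mul_mk hs ht⟩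
  · rintro ⟨x, ⟨hx, y, hy, ht⟩, z, hst, rfl⟩
    obtain ⟨y', ht', hs⟩ := act_mul_eq_some.1 hst
    obtain rfl : y = y' := Option.some.inj (ht.symm.trans ht')
    exact ⟨_, ⟨y, hy, z, hs, rfl⟩, _, ⟨x, hx, y, ht, rfl⟩, rfl, mul_mk hs ht⟩

theorem range_unit : Set.range (ArrowGroupoid.unit : Ω → Germ S) = slice (1 : S) Set.univ := by
  ext γ
  constructor
  · rintro ⟨x, rfl⟩; exact mk_mem_slice _ trivial
  · rintro ⟨x, -, y, h, rfl⟩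
    have h' := h
    rw [map_one, PartialPerm.one_apply] at h'
    obtain rfl := Option.some.inj h'
    exact ⟨x, rfl⟩

instance : ArrowGroupoid.HasOpenProducts (Germ S) where
  isOpen_range_unit := by rw [range_unit]; exact isOpen_slice 1 isOpen_univ
  isOpen_image_inv W hW := by
    rw [isOpen_iff_forall_mem_open]
    rintro _ ⟨γ, hγ, rfl⟩
    obtain ⟨_, ⟨s, U, hU, rfl⟩, hm, hs⟩ := isTopologicalBasis.exists_subset_of_mem_open hγ hW
    refine ⟨_, Set.image_mono hs, ?_, ⟨γ, hm, rfl⟩⟩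
    rw [image_inv_slice]
    exact isOpen_slice _ (isOpen_preimage _ U hU)
  isOpen_product W W' hW hW' := by
    rw [isOpen_iff_forall_mem_open]
    rintro _ ⟨a, ha, b, hb, h, rfl⟩
    obtain ⟨_, ⟨s, U, hU, rfl⟩, hm, hs⟩ := isTopologicalBasis.exists_subset_of_mem_open ha hW
    obtain ⟨_, ⟨t, V, hV, rfl⟩, hm', hs'⟩ := isTopologicalBasis.exists_subset_of_mem_open hb hW'
    refine ⟨{c : Germ S | ∃ a ∈ slice s U, ∃ b ∈ slice t V,
      ∃ h : ArrowGroupoid.src a = ArrowGroupoid.rng b, ArrowGroupoid.mul a b h = c}, ?_, ?_,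
      ⟨a, hm, b, hm', h, rfl⟩⟩
    · rintro _ ⟨a, ha, b, hb, h, rfl⟩
      exact ⟨a, hs ha, b, hs' hb, h, rfl⟩
    · rw [product_slice]
      exact isOpen_slice _ (hV.inter (isOpen_preimage t U hU))

/-- The set of all germs of `s`. -/
def bisection (s : S) : Set (Germ S) := slice s Set.univ

theorem isOpen_bisection (s : S) : IsOpen (bisection s) := isOpen_slice s isOpen_univ

theorem mk_mem_bisection {s : S} {x y : Ω} (h : act s x = some y) : mk s x y h ∈ bisection s :=
  mk_mem_slice h trivial

theorem image_inv_bisection (s : S) : ArrowGroupoid.inv '' (bisection s) = bisection (star s) := by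
  rw [bisection, image_inv_slice]
  ext γ
  constructor
  · rintro ⟨y, -, x, h, rfl⟩; exact ⟨y, trivial, x, h, rfl⟩
  · rintro ⟨y, -, x, h, rfl⟩; exact ⟨y, ⟨x, trivial, h⟩, x, h, rfl⟩

theorem injective_src_bisection (s : S) :
    Function.Injective (fun a : bisection s => ArrowGroupoid.src a.1) := by
  refine Set.injOn_iff_injective.1 ?_
  rintro _ ⟨x, -, y, h, rfl⟩ _ ⟨x', -, y', h', rfl⟩ he
  obtain rfl : x = x' := he
  obtain rfl : y = y' := Option.some.inj (h.symm.trans h')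
  rfl

theorem isEmbedding_src (s : S) :
    Topology.IsEmbedding (fun a : bisection s => ArrowGroupoid.src a.1) := by
  refine (Topology.IsOpenEmbedding.of_continuous_injective_isOpenMap
    (continuous_src.comp continuous_subtype_val) (injective_src_bisection s) ?_).isEmbedding
  intro W hW
  obtain ⟨W', hW', rfl⟩ := hW
  rw [isOpen_iff_forall_mem_open]
  rintro _ ⟨⟨γ, hγ'⟩, hγ, rfl⟩
  obtain ⟨_, ⟨t, U, hU, rfl⟩, hm, hs⟩ := isTopologicalBasis.exists_subset_of_mem_open hγ hW'
  refine ⟨_, ?_, isOpen_setOf_mem_slice s t hU, ?_⟩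
  · rintro x ⟨y, h, hm⟩
    exact ⟨⟨_, mk_mem_bisection h⟩, hs hm, rfl⟩
  · have key : ∀ γ ∈ bisection s, γ ∈ slice t U →
        ∃ y, ∃ h : act s (ArrowGroupoid.src γ) = some y, mk s _ y h ∈ slice t U := by
      rintro _ ⟨x, -, y, h, rfl⟩ hm
      exact ⟨y, h, hm⟩
    exact key γ hγ' hm

theorem continuous_inv : Continuous (ArrowGroupoid.inv : Germ S → Germ S) := by
  refine ⟨fun U hU => ?_⟩
  have h : (ArrowGroupoid.inv : Germ S → Germ S) ⁻¹' U = ArrowGroupoid.inv '' U := by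
    ext γ
    exact ⟨fun h => ⟨_, h, ArrowGroupoid.inv_inv γ⟩, by
      rintro ⟨a, ha, rfl⟩
      change ArrowGroupoid.inv (ArrowGroupoid.inv a) ∈ U
      rwa [ArrowGroupoid.inv_inv]⟩
  rw [h]
  exact ArrowGroupoid.HasOpenProducts.isOpen_image_inv U hU

theorem inv_mem_bisection {s : S} {γ : Germ S} (h : γ ∈ bisection s) :
    ArrowGroupoid.inv γ ∈ bisection (star s) := by
  rw [← image_inv_bisection]; exact ⟨γ, h, rfl⟩

theorem inv_mem_bisection' {s : S} {γ : Germ S} (h : γ ∈ bisection (star s)) :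
    ArrowGroupoid.inv γ ∈ bisection s := by
  have h := inv_mem_bisection h
  rwa [star_star] at h

/-- Inversion as a homeomorphism between the germs of `s` and the germs of `s*`. -/
noncomputable def invHomeo (s : S) : bisection s ≃ₜ bisection (star s) where
  toFun := fun a => ⟨ArrowGroupoid.inv a.1, inv_mem_bisection a.2⟩
  invFun := fun a => ⟨ArrowGroupoid.inv a.1, inv_mem_bisection' a.2⟩
  left_inv := fun a => Subtype.ext (ArrowGroupoid.inv_inv a.1)
  right_inv := fun a => Subtype.ext (ArrowGroupoid.inv_inv a.1)
  continuous_toFun := (continuous_inv.comp continuous_subtype_val).subtype_mk _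
  continuous_invFun := (continuous_inv.comp continuous_subtype_val).subtype_mk _

theorem isBisection (s : S) : ArrowGroupoid.IsBisection (bisection s) := by
  refine ⟨isEmbedding_src s, ?_⟩
  have h := (isEmbedding_src (star s)).comp (invHomeo s).isEmbedding
  convert h using 2 with a
  exact (ArrowGroupoid.src_inv _).symm

theorem isCompact_bisection {s : S} (h : IsCompact {x : Ω | ∃ y, act s x = some y}) :
    IsCompact (bisection s) := by
  have h1 : Set.range (fun a : bisection s => ArrowGroupoid.src a.1) =
      {x : Ω | ∃ y, act s x = some y} := by
    ext x
    constructor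
    · rintro ⟨⟨_, x, -, y, h, rfl⟩, rfl⟩; exact ⟨y, h⟩
    · rintro ⟨y, h⟩; exact ⟨⟨_, mk_mem_bisection h⟩, rfl⟩
  rw [isCompact_iff_isCompact_univ, (isEmbedding_src s).isCompact_iff, Set.image_univ, h1]
  exact h

/-- The indicator function of the set of germs of `s`. -/
noncomputable def ind1 (s : S) : ArrowGroupoid.ConvAlg (Germ S) :=
  ⟨(bisection s).indicator 1, by
    intro x
    refine Set.Subsingleton.finite ?_
    rintro a ⟨ha, ha'⟩ b ⟨hb, hb'⟩
    exact (isBisection s).injOn_src (Set.mem_of_indicator_ne_zero ha')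
      (Set.mem_of_indicator_ne_zero hb') (ha.trans hb.symm)⟩

theorem ind1_mul (s t : S) : ind1 s * ind1 t = ind1 (s * t) := by
  refine ArrowGroupoid.ConvAlg.ext' fun γ => ?_
  have hset := product_slice s t Set.univ Set.univ
  have hst : ∀ γ, γ ∈ bisection (s * t) ↔ ∃ a ∈ bisection s, ∃ b ∈ bisection t,
      ∃ h : ArrowGroupoid.src a = ArrowGroupoid.rng b, ArrowGroupoid.mul a b h = γ := by
    intro γ
    have h1 : γ ∈ bisection (s * t) ↔ γ ∈ slice (s * t)
        (Set.univ ∩ {x | ∃ y ∈ Set.univ, act t x = some y}) := by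
      constructor
      · rintro ⟨x, -, z, h, rfl⟩
        obtain ⟨y, hy, -⟩ := act_mul_eq_some.1 h
        exact ⟨x, ⟨trivial, y, trivial, hy⟩, z, h, rfl⟩
      · rintro ⟨x, -, z, h, rfl⟩
        exact ⟨x, trivial, z, h, rfl⟩
    rw [h1, ← hset]; rfl
  by_cases h : ∃ b ∈ bisection t, ArrowGroupoid.src b = ArrowGroupoid.src γ
  · obtain ⟨b, hb, hbs⟩ := h
    rw [ArrowGroupoid.mul_indicator_apply (isBisection t).injOn_src rfl _ hb hbs]
    have h2 : ArrowGroupoid.div γ b ∈ bisection s ↔ γ ∈ bisection (s * t) := by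
      rw [hst]
      constructor
      · intro h
        exact ⟨_, h, b, hb, ArrowGroupoid.src_div hbs.symm, by
          rw [← ArrowGroupoid.tmul_eq, ArrowGroupoid.div_tmul hbs.symm]⟩
      · rintro ⟨a, ha, b', hb', h, rfl⟩
        obtain rfl : b' = b := (isBisection t).injOn_src hb' hb
          ((ArrowGroupoid.src_mul _ _ _).symm.trans hbs.symm)
        rwa [← ArrowGroupoid.tmul_eq, ArrowGroupoid.tmul_div h]
    change (bisection s).indicator 1 _ = (bisection (s * t)).indicator 1 γ
    by_cases h3 : γ ∈ bisection (s * t)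
    · rw [Set.indicator_of_mem h3, Set.indicator_of_mem (h2.2 h3)]; rfl
    · rw [Set.indicator_of_notMem h3, Set.indicator_of_notMem (fun h => h3 (h2.1 h))]
  · rw [ArrowGroupoid.mul_indicator_apply_zero rfl _ fun b hb hs => h ⟨b, hb, hs⟩]
    change _ = (bisection (s * t)).indicator 1 γ
    rw [Set.indicator_of_notMem]
    intro hm
    obtain ⟨a, ha, b, hb, h', rfl⟩ := (hst γ).1 hm
    exact h ⟨b, hb, (ArrowGroupoid.src_mul _ _ _).symm⟩

theorem ind1_one : ind1 (1 : S) = 1 := by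
  refine ArrowGroupoid.ConvAlg.ext' fun γ => ?_
  rw [ArrowGroupoid.ConvAlg.one_apply, range_unit]; rfl

theorem ind1_mem {s : S} (h : IsCompact {x : Ω | ∃ y, act s x = some y}) :
    ind1 s ∈ ArrowGroupoid.groupoidAlgebra (Germ S) :=
  Algebra.subset_adjoin ⟨bisection s, isCompact_bisection h, isOpen_bisection s, isBisection s, rfl⟩

end Germ

end Germs

/-! ## Self-similar groups -/

namespace SelfSimilar

/-- The infinite word `x w`. -/
def cons {X : Type*} (x : X) (w : ℕ → X) : ℕ → X
  | 0 => x
  | n + 1 => w n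

/-- The infinite word `w` without its first letter. -/
def tail {X : Type*} (w : ℕ → X) : ℕ → X := fun n => w (n + 1)

theorem tail_cons {X : Type*} (x : X) (w : ℕ → X) : tail (cons x w) = w := rfl

theorem cons_tail {X : Type*} (w : ℕ → X) : cons (w 0) (tail w) = w := by
  funext n; cases n <;> rfl

/-- The distance `2 ^ (-n)` of distinct infinite words with a longest common prefix of length
`n`. -/
noncomputable def wordDist {X : Type*} (u v : ℕ → X) : ℝ :=
  (PiNat.dist (E := fun _ : ℕ => X)).dist u v

/-- A self-similar group: a faithful action of `G` by isometries on the infinite words over `X`,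
such that for all `g` and `x` there is `g|ₓ` in `G` with `g (x w) = g(x) g|ₓ(w)` for all `w`. -/
class SelfSimilarGroup (G X : Type*) [Group G] [MulAction G (ℕ → X)] : Prop
    extends FaithfulSMul G (ℕ → X) where
  isometry : ∀ (g : G) (u v : ℕ → X), wordDist (g • u) (g • v) = wordDist u v
  exists_sec : ∀ (g : G) (x : X), ∃ (y : X) (h : G), ∀ w : ℕ → X, g • cons x w = cons y (h • w)

variable (G X : Type*) [Group G] [MulAction G (ℕ → X)]

section Sections

variable [SelfSimilarGroup G X]

variable {G X}

/-- The letter `g(x)`. -/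
noncomputable def letter (g : G) (x : X) : X := (SelfSimilarGroup.exists_sec g x).choose

/-- The section `g|ₓ`. -/
noncomputable def sec (g : G) (x : X) : G := (SelfSimilarGroup.exists_sec g x).choose_spec.choose

theorem smul_cons (g : G) (x : X) (w : ℕ → X) :
    g • cons x w = cons (letter g x) (sec g x • w) :=
  (SelfSimilarGroup.exists_sec g x).choose_spec.choose_spec w

/-- The section `g|_w` at a finite word. -/
noncomputable def wordSec (g : G) : List X → G
  | [] => g
  | x :: w => wordSec (sec g x) w

end Sections

/-- The self-similar group is contracting: there is a finite `N ⊆ G` which is closed under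
sections, and such that for every `g` there is `m` with `g|_w ∈ N` for all words `w` of
length `m`. -/
def IsContracting [SelfSimilarGroup G X] : Prop :=
  ∃ N : Set G, N.Finite ∧ (∀ n ∈ N, ∀ x : X, sec n x ∈ N) ∧
    ∀ g : G, ∃ m : ℕ, ∀ w : List X, w.length = m → wordSec g w ∈ N

/-- The generators `u_g`, `s_x` and `t_x = s_x*`. The adjoint of `u_g` is `u_{g⁻¹}`. -/
inductive Gen where
  | u (g : G) : Gen
  | s (x : X) : Gen
  | t (x : X) : Gen

variable {G X}

/-- The adjoint of a generator. -/
def Gen.adj : Gen G X → Gen G X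
  | .u g => .u g⁻¹
  | .s x => .t x
  | .t x => .s x

variable (G X)

/-! ## The inverse semigroup of a self-similar group -/

/-- The generators of the inverse semigroup: those above, and a zero element `none`. -/
abbrev SGen := Option (Gen G X)

section Monoid

variable [SelfSimilarGroup G X]

open FreeMonoid in
/-- The relations of the inverse semigroup `S(G, X)`, a `*`-semigroup with zero: `g ↦ u_g` is a
unitary representation, `u_g s_x = s_{g(x)} u_{g|ₓ}` together with its adjoint, and
`s_x* s_y = δ_{x,y}`. -/
inductive SRel : FreeMonoid (SGen G X) → FreeMonoid (SGen G X) → Prop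
  | zero_mul (a : SGen G X) : SRel (of none * of a) (of none)
  | mul_zero (a : SGen G X) : SRel (of a * of none) (of none)
  | u_one : SRel (of (some (.u 1))) 1
  | u_mul (g h : G) : SRel (of (some (.u g)) * of (some (.u h))) (of (some (.u (g * h))))
  | u_s (g : G) (x : X) : SRel (of (some (.u g)) * of (some (.s x)))
      (of (some (.s (letter g x))) * of (some (.u (sec g x))))
  | t_u (g : G) (x : X) : SRel (of (some (.t x)) * of (some (.u g⁻¹)))
      (of (some (.u (sec g x)⁻¹)) * of (some (.t (letter g x))))
  | t_s (x : X) : SRel (of (some (.t x)) * of (some (.s x))) 1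
  | t_s_ne (x y : X) : x ≠ y → SRel (of (some (.t x)) * of (some (.s y))) (of none)

/-- The inverse semigroup `S(G, X)`. -/
def SMon : Type _ := PresentedMonoid (SRel G X)

instance : Monoid (SMon G X) := inferInstanceAs (Monoid (PresentedMonoid (SRel G X)))

variable {G X}

namespace SMon

/-- A generator as an element of `S(G, X)`. -/
def of (a : SGen G X) : SMon G X := PresentedMonoid.of (SRel G X) a

/-- The elements `u_g`. -/
def u (X : Type*) [MulAction G (ℕ → X)] [SelfSimilarGroup G X] (g : G) : SMon G X :=
  of (some (.u g))

/-- The elements `s_x`. -/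
def s (G : Type*) [Group G] [MulAction G (ℕ → X)] [SelfSimilarGroup G X] (x : X) : SMon G X :=
  of (some (.s x))

/-- The elements `s_x*`. -/
def t (G : Type*) [Group G] [MulAction G (ℕ → X)] [SelfSimilarGroup G X] (x : X) : SMon G X :=
  of (some (.t x))

/-- The zero element. -/
instance : Zero (SMon G X) := ⟨of none⟩

theorem eq_of_rel {a b : FreeMonoid (SGen G X)} (h : SRel G X a b) :
    (PresentedMonoid.mk (SRel G X) a : SMon G X) = PresentedMonoid.mk (SRel G X) b :=
  PresentedMonoid.mk_eq_mk_of_rel h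

theorem ofnone_mul (a : SGen G X) : (0 : SMon G X) * of a = 0 := eq_of_rel (.zero_mul a)
theorem mul_ofnone (a : SGen G X) : of a * (0 : SMon G X) = 0 := eq_of_rel (.mul_zero a)
theorem u_one : u X (1 : G) = 1 := eq_of_rel .u_one
theorem u_mul (g h : G) : u X g * u X h = u X (g * h) := eq_of_rel (.u_mul g h)
theorem u_s (g : G) (x : X) : u X g * s G x = s G (letter g x) * u X (sec g x) :=
  eq_of_rel (.u_s g x)
theorem t_u (g : G) (x : X) : t G x * u X g⁻¹ = u X (sec g x)⁻¹ * t G (letter g x) :=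
  eq_of_rel (.t_u g x)
theorem t_s (x : X) : t G x * s G x = 1 := eq_of_rel (.t_s x)
theorem t_s_ne {x y : X} (h : x ≠ y) : t G x * s G y = 0 := eq_of_rel (.t_s_ne x y h)

theorem closure_eq : Submonoid.closure (Set.range (of : SGen G X → SMon G X)) = ⊤ :=
  PresentedMonoid.closure_range_of (SRel G X)

theorem induction {p : SMon G X → Prop} (one : p 1)
    (mul : ∀ a m, p m → p (of a * m)) (m : SMon G X) : p m := by
  have hm : m ∈ Submonoid.closure (Set.range (of : SGen G X → SMon G X)) := by
    rw [closure_eq]; trivial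
  induction hm using Submonoid.closure_induction_left with
  | one => exact one
  | mul_left a ha y _ h => obtain ⟨a, rfl⟩ := ha; exact mul a y h

/-- The extension of a map on the generators that satisfies the relations. -/
def lift {M : Type*} [Monoid M] (f : SGen G X → M)
    (h : ∀ a b, SRel G X a b → FreeMonoid.lift f a = FreeMonoid.lift f b) : SMon G X →* M :=
  PresentedMonoid.lift f h

theorem lift_of {M : Type*} [Monoid M] (f : SGen G X → M)
    (h : ∀ a b, SRel G X a b → FreeMonoid.lift f a = FreeMonoid.lift f b) (a : SGen G X) :
    lift f h (of a) = f a := rfl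

open MulOpposite in
/-- The involution, as a homomorphism to the opposite monoid. -/
def starHom : SMon G X →* (SMon G X)ᵐᵒᵖ :=
  lift (fun a => op (of (a.map Gen.adj))) <| by
    intro a b h
    induction h <;> simp only [map_mul, map_one, FreeMonoid.lift_eval_of, ← op_mul, ← op_one,
      op_inj, Option.map_some, Option.map_none, Gen.adj]
    case zero_mul a => exact mul_ofnone _
    case mul_zero a => exact ofnone_mul _
    case u_one => rw [inv_one]; exact u_one
    case u_mul g h => rw [mul_inv_rev]; exact u_mul _ _
    case u_s g x => exact t_u g x
    case t_u g x => rw [inv_inv, inv_inv]; exact u_s g x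
    case t_s x => exact t_s x
    case t_s_ne x y h => exact t_s_ne h.symm

instance : StarMul (SMon G X) where
  star a := (starHom a).unop
  star_involutive a := by
    induction a using induction with
    | one => rfl
    | mul a m h =>
      dsimp only at h ⊢
      rw [map_mul, MulOpposite.unop_mul, map_mul, MulOpposite.unop_mul, h]
      congr 1
      rcases a with _ | g | x | x
      · rfl
      · change of (some (.u g⁻¹⁻¹)) = _
        rw [inv_inv]
      · rfl
      · rfl
  star_mul a b := by rw [map_mul, MulOpposite.unop_mul]

theorem star_of (a : SGen G X) : star (of a) = of (a.map Gen.adj) := rfl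

theorem star_zero' : star (0 : SMon G X) = 0 := rfl

theorem zero_mul' (a : SMon G X) : 0 * a = 0 := by
  induction a using induction with
  | one => rw [mul_one]
  | mul a m h => rw [← mul_assoc, ofnone_mul, h]

theorem mul_zero' (a : SMon G X) : a * 0 = 0 := by
  have h := congrArg star (zero_mul' (star a))
  rwa [star_mul, star_star, star_zero'] at h

/-- The elements `s_v`, for words `v`. -/
def sw (G : Type*) [Group G] [MulAction G (ℕ → X)] [SelfSimilarGroup G X] : List X → SMon G X
  | [] => 1
  | x :: v => s G x * sw G v

theorem star_s (x : X) : star (s G x) = t G x := rfl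

theorem star_u (g : G) : star (u X g) = u X g⁻¹ := rfl

theorem star_sw_mul (v : List X) : star (sw G v) * sw G v = 1 := by
  induction v with
  | nil => rw [sw, star_one, mul_one]
  | cons x v ih =>
    rw [sw, star_mul, mul_assoc, ← mul_assoc (star (s G x)), star_s, t_s, one_mul, ih]

theorem u_sw (g : G) (v : List X) : ∃ v' g', u X g * sw G v = sw G v' * u X g' := by
  induction v generalizing g with
  | nil => exact ⟨[], g, by rw [sw, mul_one, one_mul]⟩
  | cons x v ih =>
    obtain ⟨v', g', h⟩ := ih (sec g x)
    exact ⟨letter g x :: v', g', by rw [sw, sw, ← mul_assoc, u_s, mul_assoc, h, mul_assoc]⟩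

theorem sw_mul_s (w : List X) (y : X) : ∃ w', sw G w * s G y = sw G w' := by
  induction w with
  | nil => exact ⟨[y], by rw [sw, sw, sw, one_mul, mul_one]⟩
  | cons x w ih =>
    obtain ⟨w', h⟩ := ih
    exact ⟨x :: w', by rw [sw, sw, mul_assoc, h]⟩

theorem normal_form (a : SMon G X) :
    a = 0 ∨ ∃ v g w, a = sw G v * u X g * star (sw G w) := by
  induction a using induction with
  | one => exact Or.inr ⟨[], 1, [], by rw [sw, u_one, star_one, mul_one, mul_one]⟩
  | mul a m h =>
    rcases h with rfl | ⟨v, g, w, rfl⟩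
    · exact Or.inl (mul_zero' _)
    · rcases a with _ | h | x | x
      · exact Or.inl (zero_mul' _)
      · obtain ⟨v', h', e⟩ := u_sw h v
        refine Or.inr ⟨v', h' * g, w, ?_⟩
        change u X h * _ = _
        rw [← mul_assoc, ← mul_assoc, e, mul_assoc (sw G v'), u_mul]
      · refine Or.inr ⟨x :: v, g, w, ?_⟩
        change s G x * _ = _
        rw [← mul_assoc, ← mul_assoc, sw]
      · change t G x * _ = 0 ∨ ∃ v' g' w', t G x * _ = _
        rcases v with _ | ⟨y, v⟩
        · obtain ⟨w', e⟩ := sw_mul_s (G := G) w (letter g⁻¹ x)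
          refine Or.inr ⟨[], (sec g⁻¹ x)⁻¹, w', ?_⟩
          rw [sw, one_mul, one_mul, ← e, star_mul, star_s, ← mul_assoc, ← mul_assoc, ← t_u, inv_inv]
        · by_cases h : x = y
          · subst h
            refine Or.inr ⟨v, g, w, ?_⟩
            rw [sw, ← mul_assoc, ← mul_assoc, ← mul_assoc, t_s, one_mul]
          · refine Or.inl ?_
            rw [sw, ← mul_assoc, ← mul_assoc, ← mul_assoc, t_s_ne h, zero_mul', zero_mul', zero_mul']

theorem star_sw_mul_sw (v w : List X) : star (sw G v) * sw G w = 0 ∨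
    (∃ a, sw G w = sw G v * sw G a) ∨ (∃ a, sw G v = sw G w * sw G a) := by
  induction v generalizing w with
  | nil => exact Or.inr (Or.inl ⟨w, by rw [sw, one_mul]⟩)
  | cons x v ih =>
    rcases w with _ | ⟨y, w⟩
    · exact Or.inr (Or.inr ⟨x :: v, by rw [sw.eq_def G [], one_mul]⟩)
    · by_cases h : x = y
      · subst h
        rcases ih w with h | ⟨a, h⟩ | ⟨a, h⟩
        · refine Or.inl ?_
          rw [sw, sw, star_mul, star_s, mul_assoc, ← mul_assoc (t G x), t_s, one_mul, h]
        · exact Or.inr (Or.inl ⟨a, by rw [sw, sw, h, mul_assoc]⟩)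
        · exact Or.inr (Or.inr ⟨a, by rw [sw, sw, h, mul_assoc]⟩)
      · refine Or.inl ?_
        rw [sw, sw, star_mul, star_s, mul_assoc, ← mul_assoc (t G x), t_s_ne h, zero_mul', mul_zero']

theorem mul_star_mul' (a : SMon G X) : a * star a * a = a := by
  rcases normal_form a with rfl | ⟨v, g, w, rfl⟩
  · rw [zero_mul', zero_mul']
  · have hu : u X g * u X g⁻¹ = 1 := by rw [u_mul, mul_inv_cancel, u_one]
    calc _ = sw G v * (u X g * (star (sw G w) * sw G w) * u X g⁻¹) * (star (sw G v) * sw G v) *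
          u X g * star (sw G w) := by
          simp only [star_mul, star_star, star_u, mul_assoc]
      _ = _ := by rw [star_sw_mul, star_sw_mul, mul_one (u X g), hu, mul_one, mul_one]

theorem star_mul_self_form (a : SMon G X) :
    star a * a = 0 ∨ ∃ w, star a * a = sw G w * star (sw G w) := by
  rcases normal_form a with rfl | ⟨v, g, w, rfl⟩
  · exact Or.inl (mul_zero' _)
  · refine Or.inr ⟨w, ?_⟩
    have hu : u X g⁻¹ * u X g = 1 := by rw [u_mul, inv_mul_cancel, u_one]
    calc _ = sw G w * (u X g⁻¹ * (star (sw G v) * sw G v) * u X g) * star (sw G w) := by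
          simp only [star_mul, star_star, star_u, mul_assoc]
      _ = _ := by rw [star_sw_mul, mul_one, hu, mul_one]

theorem commute_proj (v w : List X) : sw G v * star (sw G v) * (sw G w * star (sw G w)) =
    sw G w * star (sw G w) * (sw G v * star (sw G v)) := by
  have aux : ∀ v a : List X, ∀ w, sw G w = sw G v * sw G a →
      sw G v * star (sw G v) * (sw G w * star (sw G w)) = sw G w * star (sw G w) := by
    intro v a w h
    rw [← mul_assoc, mul_assoc (sw G v), h, ← mul_assoc (star (sw G v)), star_sw_mul, one_mul]
  have aux' : ∀ v a : List X, ∀ w, sw G w = sw G v * sw G a →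
      sw G w * star (sw G w) * (sw G v * star (sw G v)) = sw G w * star (sw G w) := by
    intro v a w h
    simpa using congrArg star (aux v a w h)
  rcases star_sw_mul_sw (G := G) v w with h | ⟨a, h⟩ | ⟨a, h⟩
  · have h' : star (sw G w) * sw G v = 0 := by simpa [star_zero'] using congrArg star h
    rw [← mul_assoc, mul_assoc (sw G v), h, ← mul_assoc, mul_assoc (sw G w), h', mul_zero',
      mul_zero', zero_mul', zero_mul']
  · rw [aux v a w h, aux' v a w h]
  · rw [aux w a v h, aux' w a v h]

instance : IsInverseMonoid (SMon G X) where
  mul_star_mul := mul_star_mul'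
  idem_comm := by
    have proj : ∀ a b : SMon G X, star a * a * (star b * b) = star b * b * (star a * a) := by
      intro a b
      rcases star_mul_self_form a with ha | ⟨v, ha⟩ <;>
        rcases star_mul_self_form b with hb | ⟨w, hb⟩ <;> rw [ha, hb]
      · rw [zero_mul', mul_zero']
      · rw [zero_mul', mul_zero']
      · exact commute_proj v w
    have idem : ∀ e : SMon G X, e * e = e → e = star e * e := by
      intro e he
      have hs : star e * star e = star e := by rw [← star_mul, he]
      have h1 : e * star e * e = e := mul_star_mul' e
      have h2 : star e * e * star e = star e := by simpa using mul_star_mul' (star e)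
      have hp := proj e (star e)
      rw [star_star] at hp
      have hl : star e * e * (e * star e) = star e := by
        rw [← mul_assoc, mul_assoc (star e) e e, he, h2]
      have hr : e * star e * (star e * e) = e := by
        rw [← mul_assoc, mul_assoc e (star e) (star e), hs, h1]
      rw [hl, hr] at hp
      conv_rhs => rw [hp, he]
    intro e f he hf
    rw [idem e he.eq, idem f hf.eq]
    exact proj e f

end SMon

end Monoid

/-! ## The action on infinite words and the groupoid of germs -/

variable {G X}

theorem smul_cont [SelfSimilarGroup G X] [TopologicalSpace X] [DiscreteTopology X] (g : G) :
    Continuous fun w : ℕ → X => g • w := by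
  refine ⟨fun U hU => ?_⟩
  rw [PiNat.isOpen_iff_dist] at hU ⊢
  intro w hw
  obtain ⟨ε, hε, h⟩ := hU _ hw
  refine ⟨ε, hε, fun v hv => h _ ?_⟩
  exact (SelfSimilarGroup.isometry (G := G) g w v).trans_lt hv

/-- The partial bijection `w ↦ x w`. -/
noncomputable def consPerm {X : Type*} (x : X) : PartialPerm (ℕ → X) :=
  open scoped Classical in
  (⟨fun w => some (cons x w), fun v => if v 0 = x then some (tail v) else none, by
    intro w v
    constructor
    · intro h
      by_cases hx : v 0 = x
      · rw [if_pos hx] at h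
        obtain rfl : tail v = w := Option.some.inj h
        rw [← hx, cons_tail]
      · rw [if_neg hx] at h; cases h
    · intro h
      obtain rfl : cons x w = v := Option.some.inj h
      exact if_pos rfl⟩ : (ℕ → X) ≃. (ℕ → X))

variable (X) in
/-- The bijection `w ↦ g(w)`. -/
def smulPerm (g : G) : PartialPerm (ℕ → X) := (MulAction.toPerm g : Equiv.Perm (ℕ → X)).toPEquiv

theorem consPerm_apply (x : X) (w : ℕ → X) : consPerm x w = some (cons x w) := rfl

theorem smulPerm_apply (g : G) (w : ℕ → X) : smulPerm X g w = some (g • w) := rfl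

theorem star_consPerm_eq_some {x : X} {v w : ℕ → X} :
    star (consPerm x) v = some w ↔ v = cons x w := by
  rw [PartialPerm.star_eq_some, consPerm_apply, Option.some_inj, eq_comm]

theorem star_smulPerm (g : G) : star (smulPerm X g) = smulPerm X g⁻¹ := by
  refine PartialPerm.ext fun w => ?_
  rw [smulPerm_apply, PartialPerm.star_eq_some, smulPerm_apply, smul_inv_smul]

/-- The partial bijections of the set of infinite words given by the generators. -/
noncomputable def genPerm : SGen G X → PartialPerm (ℕ → X)
  | none => 0
  | some (.u g) => smulPerm X g
  | some (.s x) => consPerm x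
  | some (.t x) => star (consPerm x)

section Action

variable [SelfSimilarGroup G X]

theorem smulPerm_mul_consPerm (g : G) (x : X) :
    smulPerm X g * consPerm x = consPerm (letter g x) * smulPerm X (sec g x) := by
  refine PartialPerm.ext fun w => ?_
  have h1 : (smulPerm X g * consPerm x) w = some (g • cons x w) :=
    PartialPerm.mul_eq_some.2 ⟨_, rfl, rfl⟩
  have h2 : (consPerm (letter g x) * smulPerm X (sec g x)) w =
      some (cons (letter g x) (sec g x • w)) := PartialPerm.mul_eq_some.2 ⟨_, rfl, rfl⟩
  rw [h1, h2, smul_cons]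

variable (G X) in
/-- The action of `S(G, X)` on the infinite words: `s_v u_g s_w*` maps `w ρ` to `v g(ρ)`. -/
noncomputable def actHom : SMon G X →* PartialPerm (ℕ → X) :=
  SMon.lift genPerm <| by
    intro a b h
    induction h <;> simp only [map_mul, map_one, FreeMonoid.lift_eval_of, genPerm]
    case zero_mul a => exact zero_mul _
    case mul_zero a => exact mul_zero _
    case u_one =>
      refine PartialPerm.ext fun w => ?_
      rw [smulPerm_apply, one_smul]; rfl
    case u_mul g h =>
      refine PartialPerm.ext fun w => ?_
      rw [smulPerm_apply, mul_smul]
      exact PartialPerm.mul_eq_some.2 ⟨_, rfl, rfl⟩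
    case u_s g x => exact smulPerm_mul_consPerm g x
    case t_u g x =>
      have h := congrArg star (smulPerm_mul_consPerm g x)
      rwa [star_mul, star_mul, star_smulPerm, star_smulPerm] at h
    case t_s x =>
      refine PartialPerm.ext fun w => ?_
      exact PartialPerm.mul_eq_some.2 ⟨_, rfl, star_consPerm_eq_some.2 rfl⟩
    case t_s_ne x y h =>
      refine PartialPerm.ext fun w => ?_
      rw [PartialPerm.zero_apply, Option.eq_none_iff_forall_ne_some]
      intro v hv
      obtain ⟨w', h1, h2⟩ := PartialPerm.mul_eq_some.1 hv
      obtain rfl : cons y w = w' := Option.some.inj h1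
      exact h (congrFun (star_consPerm_eq_some.1 h2) 0).symm

theorem actHom_of (a : SGen G X) : actHom G X (SMon.of a) = genPerm a := rfl

theorem actHom_star (a : SMon G X) : actHom G X (star a) = star (actHom G X a) := by
  induction a using SMon.induction with
  | one => rw [star_one, map_one, star_one]
  | mul a m h =>
    rw [star_mul, map_mul, map_mul, star_mul, h]
    congr 1
    rcases a with _ | g | x | x
    · rfl
    · exact (star_smulPerm g).symm
    · rfl
    · rfl

variable [TopologicalSpace X] [DiscreteTopology X]

theorem cont_cons (x : X) : Continuous (cons x) := by
  refine continuous_pi fun n => ?_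
  cases n with
  | zero => exact continuous_const
  | succ n => exact continuous_apply n

theorem cont_tail : Continuous (tail : (ℕ → X) → ℕ → X) :=
  continuous_pi fun n => continuous_apply (n + 1)

theorem isOpen_genPerm (a : SGen G X) (U : Set (ℕ → X)) (hU : IsOpen U) :
    IsOpen {w | ∃ v ∈ U, genPerm a w = some v} := by
  rcases a with _ | g | x | x
  · convert isOpen_empty
    refine Set.eq_empty_of_forall_notMem ?_
    rintro w ⟨v, -, h⟩
    cases h
  · convert hU.preimage (smul_cont (X := X) g) using 1
    ext w
    constructor
    · rintro ⟨v, hv, h⟩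
      obtain rfl : g • w = v := Option.some.inj h
      exact hv
    · intro h; exact ⟨_, h, rfl⟩
  · convert hU.preimage (cont_cons x) using 1
    ext w
    constructor
    · rintro ⟨v, hv, h⟩
      obtain rfl : cons x w = v := Option.some.inj h
      exact hv
    · intro h; exact ⟨_, h, rfl⟩
  · convert ((isOpen_discrete {x}).preimage (continuous_apply 0)).inter
      (hU.preimage (cont_tail (X := X))) using 1
    ext w
    constructor
    · rintro ⟨v, hv, h⟩
      obtain rfl := star_consPerm_eq_some.1 h
      exact ⟨rfl, hv⟩
    · rintro ⟨h, h'⟩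
      refine ⟨tail w, h', star_consPerm_eq_some.2 ?_⟩
      obtain rfl : w 0 = x := h
      exact (cons_tail w).symm

noncomputable instance : PartialAction (SMon G X) (ℕ → X) where
  act := actHom G X
  act_star := actHom_star
  isOpen_preimage a := by
    induction a using SMon.induction with
    | one =>
      intro U hU
      convert hU using 1
      ext w
      rw [map_one]
      constructor
      · rintro ⟨v, hv, h⟩
        obtain rfl : w = v := Option.some.inj h
        exact hv
      · intro h; exact ⟨w, h, rfl⟩
    | mul a m h =>
      intro U hU
      convert h _ (isOpen_genPerm a U hU) using 1
      ext w
      constructor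
      · rintro ⟨v, hv, h⟩
        rw [map_mul] at h
        obtain ⟨y, h1, h2⟩ := PartialPerm.mul_eq_some.1 h
        exact ⟨y, ⟨v, hv, h2⟩, h1⟩
      · rintro ⟨y, ⟨v, hv, h2⟩, h1⟩
        refine ⟨v, hv, ?_⟩
        rw [map_mul]
        exact PartialPerm.mul_eq_some.2 ⟨y, h1, h2⟩

variable (G X) in
/-- The groupoid `𝒢(G, X)`: the groupoid of germs of the action of `S(G, X)` on the infinite
words. -/
abbrev germGroupoid : Type _ := Germ (SMon G X)

/-! ## The algebra `ℂ(G, X)` -/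

variable (G X) in
open FreeAlgebra in
/-- The relations of the `*`-algebra `ℂ(G, X)`: `g ↦ u_g` is a unitary representation,
`u_g s_x = s_{g(x)} u_{g|ₓ}` together with its adjoint, `s_x* s_y = δ_{x,y}`, and
`∑ₓ s_x s_x* = 1`. -/
inductive AlgRel [Fintype X] : FreeAlgebra ℂ (Gen G X) → FreeAlgebra ℂ (Gen G X) → Prop
  | u_one : AlgRel (ι ℂ (.u 1)) 1
  | u_mul (g h : G) : AlgRel (ι ℂ (.u g) * ι ℂ (.u h)) (ι ℂ (.u (g * h)))
  | u_s (g : G) (x : X) :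
      AlgRel (ι ℂ (.u g) * ι ℂ (.s x)) (ι ℂ (.s (letter g x)) * ι ℂ (.u (sec g x)))
  | t_u (g : G) (x : X) :
      AlgRel (ι ℂ (.t x) * ι ℂ (.u g⁻¹)) (ι ℂ (.u (sec g x)⁻¹) * ι ℂ (.t (letter g x)))
  | t_s (x : X) : AlgRel (ι ℂ (.t x) * ι ℂ (.s x)) 1
  | t_s_ne (x y : X) : x ≠ y → AlgRel (ι ℂ (.t x) * ι ℂ (.s y)) 0
  | sum_s_t : AlgRel (∑ x : X, ι ℂ (.s x) * ι ℂ (.t x)) 1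

variable (G X) in
/-- The algebra `ℂ(G, X)`. -/
abbrev SSAlgebra [Fintype X] : Type _ := RingQuot (AlgRel G X)

theorem isCompact_dom [Finite X] (a : Gen G X) :
    IsCompact {w : ℕ → X | ∃ v, PartialAction.act (SMon.of (some a)) w = some v} := by
  refine IsClosed.isCompact ?_
  rcases a with g | x | x
  · convert isClosed_univ
    exact Set.eq_univ_of_forall fun w => ⟨_, rfl⟩
  · convert isClosed_univ
    exact Set.eq_univ_of_forall fun w => ⟨_, rfl⟩
  · convert (isClosed_discrete {x}).preimage (continuous_apply (A := fun _ : ℕ => X) 0) using 1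
    ext w
    constructor
    · rintro ⟨v, h⟩
      obtain rfl := star_consPerm_eq_some.1 h
      rfl
    · rintro h
      obtain rfl : w 0 = x := h
      exact ⟨tail w, star_consPerm_eq_some.2 (cons_tail w).symm⟩

/-- The element of `ℂ𝒢(G, X)` which is the indicator function of the set of the germs of a
generator. -/
noncomputable def genFun [Finite X] (a : Gen G X) :
    ArrowGroupoid.groupoidAlgebra (germGroupoid G X) :=
  ⟨Germ.ind1 (SMon.of (some a)), Germ.ind1_mem (isCompact_dom a)⟩

theorem ind1_zero : Germ.ind1 (0 : SMon G X) = 0 := by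
  refine ArrowGroupoid.ConvAlg.ext' fun γ => ?_
  refine Set.indicator_of_notMem ?_ _
  rintro ⟨x, -, y, h, rfl⟩
  cases h

theorem ind1_s_t (x : X) (γ : germGroupoid G X) : Germ.ind1 (SMon.s G x * SMon.t G x) γ =
    open scoped Classical in
    if ArrowGroupoid.src γ 0 = x then (1 : ArrowGroupoid.ConvAlg (germGroupoid G X)) γ else 0 := by
  have hact : ∀ w v : ℕ → X, PartialAction.act (SMon.s G x * SMon.t G x) w = some v ↔
      w 0 = x ∧ v = w := by
    intro w v
    rw [PartialAction.act_mul_eq_some]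
    constructor
    · rintro ⟨y, h1, h2⟩
      obtain rfl := star_consPerm_eq_some.1 h1
      exact ⟨rfl, (Option.some.inj h2).symm⟩
    · rintro ⟨rfl, rfl⟩
      exact ⟨tail v, star_consPerm_eq_some.2 (cons_tail v).symm, congrArg some (cons_tail v)⟩
  have hid : IsIdempotentElem (SMon.s G x * SMon.t G x) :=
    IsInverseMonoid.idem_mul_star (SMon.s G x)
  have hmem : γ ∈ Germ.bisection (SMon.s G x * SMon.t G x) ↔
      ArrowGroupoid.src γ 0 = x ∧ γ ∈ Set.range (ArrowGroupoid.unit : (ℕ → X) → germGroupoid G X) := by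
    constructor
    · rintro ⟨w, -, v, h, rfl⟩
      obtain ⟨h0, rfl⟩ := (hact _ _).1 h
      exact ⟨h0, v, Germ.mk_eq_mk.2 ⟨rfl, _, hid, h, by rw [one_mul, hid.eq]⟩⟩
    · rintro ⟨h0, w, rfl⟩
      have h : PartialAction.act (SMon.s G x * SMon.t G x) w = some w := (hact _ _).2 ⟨h0, rfl⟩
      exact ⟨w, trivial, w, h, Germ.mk_eq_mk.2 ⟨rfl, _, hid, h, by rw [one_mul, hid.eq]⟩⟩
  rw [ArrowGroupoid.ConvAlg.one_apply]
  change (Germ.bisection _).indicator 1 γ = _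
  classical
  by_cases h0 : ArrowGroupoid.src γ 0 = x
  · rw [if_pos h0, Set.indicator_apply, Set.indicator_apply]
    exact if_congr (hmem.trans (and_iff_right h0)) rfl rfl
  · rw [if_neg h0, Set.indicator_of_notMem fun h => h0 (hmem.1 h).1]

variable (G X) in
/-- The canonical homomorphism `ℂ(G, X) → ℂ𝒢(G, X)`, mapping `u_g`, `s_x` and `s_x*` to the
indicator functions of the sets of germs of `w ↦ g(w)`, `w ↦ x w` and `x w ↦ w`. -/
noncomputable def toGroupoidAlgebra [Fintype X] :
    SSAlgebra G X →ₐ[ℂ] ArrowGroupoid.groupoidAlgebra (germGroupoid G X) :=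
  RingQuot.liftAlgHom ℂ ⟨FreeAlgebra.lift ℂ genFun, by
    intro a b h
    apply Subtype.ext
    induction h <;>
      simp only [map_mul, map_one, map_zero, map_sum, FreeAlgebra.lift_ι_apply, genFun,
        MulMemClass.mk_mul_mk, Germ.ind1_mul, OneMemClass.coe_one, ZeroMemClass.coe_zero,
        AddSubmonoidClass.coe_finsetSum]
    case u_one => exact (congrArg Germ.ind1 SMon.u_one).trans Germ.ind1_one
    case u_mul g h => exact congrArg Germ.ind1 (SMon.u_mul g h)
    case u_s g x => exact congrArg Germ.ind1 (SMon.u_s g x)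
    case t_u g x => exact congrArg Germ.ind1 (SMon.t_u g x)
    case t_s x => exact (congrArg Germ.ind1 (SMon.t_s x)).trans Germ.ind1_one
    case t_s_ne x y h => exact (congrArg Germ.ind1 (SMon.t_s_ne h)).trans ind1_zero
    case sum_s_t =>
      refine ArrowGroupoid.ConvAlg.ext' fun γ => ?_
      classical
      rw [Submodule.coe_sum, Finset.sum_apply]
      exact (Finset.sum_congr rfl fun x _ => ind1_s_t x γ).trans (by simp)⟩

variable (G X) in
/-- The algebraic essential ideal of `𝒢(G, X)` as an ideal of `ℂ(G, X)`: the elements whose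
associated function on `𝒢(G, X)` has a strict support with empty interior. -/
noncomputable def algEssentialIdeal [Fintype X] : TwoSidedIdeal (SSAlgebra G X) :=
  (ArrowGroupoid.essentialIdeal (germGroupoid G X)).comap (toGroupoidAlgebra G X)

theorem mem_algEssentialIdeal [Fintype X] (a : SSAlgebra G X) : a ∈ algEssentialIdeal G X ↔
    interior {γ : germGroupoid G X | (toGroupoidAlgebra G X a).1 γ ≠ 0} = ∅ := by
  rw [← ArrowGroupoid.mem_essentialIdeal, algEssentialIdeal, TwoSidedIdeal.mem_comap]

end Action

end SelfSimilar

/-- A unital associative algebra is finitely presented if it is the quotient of a free algebra of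
finite rank by a two-sided ideal which is generated by a finite set. -/
def IsFinitelyPresentedAlgebra (k A : Type*) [Field k] [Ring A] [Algebra k A] : Prop :=
  ∃ (n : ℕ) (φ : FreeAlgebra k (Fin n) →ₐ[k] A) (R : Set (FreeAlgebra k (Fin n))),
    Function.Surjective φ ∧ R.Finite ∧ TwoSidedIdeal.ker φ = TwoSidedIdeal.span R

/-! The proof has two independent halves: `ℂ(G, X)` is finitely presented, and the essential ideal
is generated, as a two-sided ideal, by a finite-dimensional subspace.

For the first half, enlarge the contracting set to a finite `N` which contains `1` and is closed
under sections. Every `u_g` expands as `∑ s_{g(v)} u_{g|_v} s_v*` over the words `v` of a given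
length, and for a large length all the sections lie in `N`. So the `s_x`, `s_x*` and the `u_n` with
`n ∈ N` generate. Finitely many relations among them suffice: the Cuntz relations, `u_1 = 1`, the
one-step expansion of each `u_n`, and for `g, h ∈ N` the equation of `u_g u_h` with the expansion of
`gh` to a uniform depth `m` (`IsNucleusRep`). In any algebra where they hold, define `u_g` for
arbitrary `g` by a deep expansion. The one-step relations make it independent of the depth. A
product of two expansions of equal depth collapses, by orthogonality, to products of elements of `N`
at the leaves. This gives a homomorphism from `ℂ(G, X)` (`IsNucleusRep.exists_algHom`).

For the second half, let `a` be in the essential ideal. Multiplying `a` on the right by `s_w`, for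
`w` in a suitable complete prefix code, gives combinations of elements `s_v u_n` with `n ∈ N`
(`Reducible.of_secMem`), and `a` is recovered as `∑ a s_w s_w*`. Group such a combination by the
length of `v`. A germ has a well-defined degree (`degree_eq_of_germ_eq`), so components of different
degree have disjoint strict supports, and each of them again has a strict support with empty
interior (`component_mem_algEssentialIdeal`). A component `b` of positive degree equals `∑ s_x (s_x*
b)`, where the `s_x* b` lie in the ideal and have degree one less. By induction everything reduces
to the ideal's intersection with the span of the `u_n`, `n ∈ N`
(`eq_zero_of_mem_algEssentialIdeal`). A finite spanning set of that intersection is added to the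
relators. -/

namespace SelfSimilar

/-! ### Section calculus and the depth at which sections enter the nucleus -/

section Basic

variable {G X : Type*} [Group G] [MulAction G (ℕ → X)] [SelfSimilarGroup G X]

/-- Letters and sections are obtained by choice; faithfulness of the action makes the choice unique,
and the identities for `1`, products and inverses follow from this uniqueness. -/
theorem letter_sec_unique {g h : G} {x y : X}
    (H : ∀ w : ℕ → X, g • cons x w = cons y (h • w)) : letter g x = y ∧ sec g x = h := by
  have key : ∀ w : ℕ → X, cons (letter g x) (sec g x • w) = cons y (h • w) := fun w => by
    rw [← smul_cons, H]
  -- Comparing first letters needs only one infinite word; the constant word at `x` is available.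
  refine ⟨congrFun (key fun _ => x) 0, FaithfulSMul.eq_of_smul_eq_smul (α := ℕ → X) fun w => ?_⟩
  exact congrArg tail (key w)

theorem letter_sec_one (x : X) : letter (1 : G) x = x ∧ sec (1 : G) x = 1 :=
  letter_sec_unique fun w => by rw [one_smul, one_smul]

theorem letter_sec_mul (g h : G) (x : X) : letter (g * h) x = letter g (letter h x) ∧
    sec (g * h) x = sec g (letter h x) * sec h x :=
  letter_sec_unique fun w => by rw [mul_smul, smul_cons, smul_cons, mul_smul]

theorem letter_inv_letter (g : G) (x : X) : letter g⁻¹ (letter g x) = x := by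
  rw [← (letter_sec_mul g⁻¹ g x).1, inv_mul_cancel, (letter_sec_one x).1]

theorem sec_inv_letter (g : G) (x : X) : sec g⁻¹ (letter g x) = (sec g x)⁻¹ := by
  rw [eq_inv_iff_mul_eq_one, ← (letter_sec_mul g⁻¹ g x).2, inv_mul_cancel, (letter_sec_one x).2]

theorem letter_injective (g : G) : Function.Injective (letter g : X → X) :=
  Function.LeftInverse.injective (letter_inv_letter g)

/-- All the sections of `g` at the words of length `k` are in `N`. -/
def SecMem (N : Set G) : ℕ → G → Prop
  | 0, g => g ∈ N
  | k + 1, g => ∀ x : X, SecMem N k (sec g x)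

theorem secMem_of_wordSec {N : Set G} {k : ℕ} {g : G}
    (h : ∀ w : List X, w.length = k → wordSec g w ∈ N) : SecMem (X := X) N k g := by
  induction k generalizing g with
  | zero => exact h [] rfl
  | succ k ih =>
    exact fun x => ih fun w hw => h (x :: w) (by rw [List.length_cons, hw])

variable {N : Set G} (hN : ∀ g ∈ N, ∀ x : X, sec g x ∈ N)
include hN

theorem SecMem.succ {k : ℕ} {g : G} (h : SecMem (X := X) N k g) : SecMem (X := X) N (k + 1) g := by
  induction k generalizing g with
  | zero => exact hN g h
  | succ k ih => exact fun x => ih (h x)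

theorem SecMem.mono {k l : ℕ} (hkl : k ≤ l) {g : G} (h : SecMem (X := X) N k g) :
    SecMem (X := X) N l g := by
  induction hkl with
  | refl => exact h
  | step _ ih => exact ih.succ hN

end Basic

/-- Adding `1` to the contracting set keeps it finite and closed under sections. Since there are
only finitely many products of two elements of it, one depth `m` serves them all, which keeps the
list of multiplication relations finite and uniform. -/
theorem IsContracting.exists_nucleus {G X : Type*} [Group G] [MulAction G (ℕ → X)]
    [SelfSimilarGroup G X] (hG : IsContracting G X) :
    ∃ (N : Set G) (m : ℕ), N.Finite ∧ 1 ∈ N ∧ (∀ g ∈ N, ∀ x : X, sec g x ∈ N) ∧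
      (∀ g, ∃ k, SecMem (X := X) N k g) ∧ ∀ g ∈ N, ∀ h ∈ N, SecMem (X := X) N m (g * h) := by
  obtain ⟨N, hf, hs, hw⟩ := hG
  have hs' : ∀ g ∈ insert 1 N, ∀ x : X, sec g x ∈ insert 1 N := by
    rintro g (rfl | hg) x
    · exact Or.inl (letter_sec_one x).2
    · exact Or.inr (hs g hg x)
  have hk : ∀ g, ∃ k, SecMem (X := X) (insert 1 N) k g := fun g =>
    (hw g).imp fun k h => secMem_of_wordSec fun w hw => Or.inr (h w hw)
  choose k hk' using hk
  have hf' := hf.insert 1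
  obtain ⟨m, hm⟩ := ((hf'.prod hf').image fun p : G × G => k (p.1 * p.2)).bddAbove
  refine ⟨insert 1 N, m, hf', Or.inl rfl, hs', fun g => ⟨k g, hk' g⟩, fun g hg h hh => ?_⟩
  exact (hk' (g * h)).mono hs' (hm ⟨(g, h), ⟨hg, hh⟩, rfl⟩)

/-! ### Finitely many relations over the nucleus suffice for `ℂ(G, X)` -/

section Spread

variable {G X : Type*} [Group G] [Fintype X] [MulAction G (ℕ → X)] [SelfSimilarGroup G X]
  {B : Type*} [Ring B]

/-- The sum of `s_{g(v)} u_{g|_v} t_v` over the words `v` of length `k`. -/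
noncomputable def spread (s t : X → B) (u : G → B) : ℕ → G → B
  | 0, g => u g
  | k + 1, g => ∑ x : X, s (letter g x) * spread s t u k (sec g x) * t x

theorem map_spread {B' F : Type*} [Ring B'] [FunLike F B B'] [RingHomClass F B B'] (φ : F)
    (s t : X → B) (u : G → B) (k : ℕ) (g : G) :
    φ (spread s t u k g) = spread (fun x => φ (s x)) (fun x => φ (t x)) (fun g => φ (u g)) k g := by
  induction k generalizing g with
  | zero => rfl
  | succ k ih => simp only [spread, map_sum, map_mul, ih]

/-- Only the values of `u` at the leaves enter, and these lie in `N`. Hence `u` may take arbitrary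
values outside `N`. -/
theorem spread_congr {N : Set G} (s t : X → B) {u u' : G → B} (h : ∀ g ∈ N, u g = u' g) {k : ℕ}
    {g : G} (hg : SecMem (X := X) N k g) : spread s t u k g = spread s t u' k g := by
  induction k generalizing g with
  | zero => exact h g hg
  | succ k ih =>
    rw [spread, spread]
    exact Finset.sum_congr rfl fun x _ => by rw [ih (hg x)]

/-- The relations between `s_x`, `s_x*` and the elements `u_g` with `g` in the nucleus `N` which
define the algebra `ℂ(G, X)`, if the sections of the elements of `N N` at words of length `m`
are in `N`. -/
structure IsNucleusRep (N : Set G) (m : ℕ) (s t : X → B) (u : G → B) : Prop where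
  one : u 1 = 1
  t_s : ∀ x, t x * s x = 1
  t_s_ne : ∀ x y, x ≠ y → t x * s y = 0
  sum_s_t : ∑ x, s x * t x = 1
  expand : ∀ g ∈ N, u g = spread s t u 1 g
  mul : ∀ g ∈ N, ∀ h ∈ N, u g * u h = spread s t u m (g * h)

namespace IsNucleusRep

variable {N : Set G} {m : ℕ} {s t : X → B} {u : G → B} (H : IsNucleusRep N m s t u)
include H

/-- Orthogonality leaves one summand. This is the relation `u_g s_x = s_{g(x)} u_{g|ₓ}` for
expansions, at the cost of one level of depth. -/
theorem spread_succ_mul_s (k : ℕ) (g : G) (x : X) :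
    spread s t u (k + 1) g * s x = s (letter g x) * spread s t u k (sec g x) := by
  rw [spread, Finset.sum_mul, Finset.sum_eq_single x]
  · rw [mul_assoc, H.t_s, mul_one]
  · intro y _ hy
    rw [mul_assoc, H.t_s_ne y x hy, mul_zero]
  · exact fun h => absurd (Finset.mem_univ x) h

/-- The adjoint relation; here the surviving summand is unique because `g` is injective on letters.
-/
theorem t_mul_spread_succ (k : ℕ) (g : G) (x : X) :
    t (letter g x) * spread s t u (k + 1) g = spread s t u k (sec g x) * t x := by
  rw [spread, Finset.mul_sum, Finset.sum_eq_single x]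
  · rw [← mul_assoc, ← mul_assoc, H.t_s, one_mul]
  · intro y _ hy
    rw [← mul_assoc, ← mul_assoc, H.t_s_ne _ _ fun h => hy (letter_injective g h).symm, zero_mul,
      zero_mul]
  · exact fun h => absurd (Finset.mem_univ x) h

theorem spread_succ_mul_spread_succ (k l : ℕ) (g h : G) :
    spread s t u (k + 1) g * spread s t u (l + 1) h = ∑ x, s (letter g (letter h x)) *
      (spread s t u k (sec g (letter h x)) * spread s t u l (sec h x)) * t x := by
  rw [spread.eq_2 s t u h, Finset.mul_sum]
  refine Finset.sum_congr rfl fun x _ => ?_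
  rw [← mul_assoc, ← mul_assoc, H.spread_succ_mul_s, mul_assoc (s _)]

theorem congr (hN : ∀ g ∈ N, ∀ x : X, sec g x ∈ N) (h1 : 1 ∈ N)
    (hm : ∀ g ∈ N, ∀ h ∈ N, SecMem (X := X) N m (g * h)) {u' : G → B} (h : ∀ g ∈ N, u g = u' g) :
    IsNucleusRep N m s t u' where
  one := (h 1 h1).symm.trans H.one
  t_s := H.t_s
  t_s_ne := H.t_s_ne
  sum_s_t := H.sum_s_t
  expand g hg := by rw [← h g hg, H.expand g hg, spread_congr s t h (k := 1) (hN g hg)]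
  mul g hg g' hg' := by
    rw [← h g hg, ← h g' hg', H.mul g hg g' hg', spread_congr s t h (hm g hg g' hg')]

variable (hN : ∀ g ∈ N, ∀ x : X, sec g x ∈ N)

/-- The one-step expansion is applied at every leaf; it is only assumed on `N`, so all the leaves
have to be in `N`. -/
theorem spread_succ {k : ℕ} {g : G} (h : SecMem (X := X) N k g) :
    spread s t u (k + 1) g = spread s t u k g := by
  induction k generalizing g with
  | zero => exact (H.expand g h).symm
  | succ k ih =>
    rw [spread, spread]
    exact Finset.sum_congr rfl fun x _ => by rw [ih (h x)]

include hN

theorem spread_of_le {k l : ℕ} (hkl : k ≤ l) {g : G} (h : SecMem (X := X) N k g) :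
    spread s t u l g = spread s t u k g := by
  induction hkl with
  | refl => rfl
  | step hkl ih => rw [H.spread_succ (h.mono hN hkl), ih]

theorem spread_eq {k l : ℕ} {g : G} (h : SecMem (X := X) N k g) (h' : SecMem (X := X) N l g) :
    spread s t u k g = spread s t u l g := by
  rcases le_total k l with hkl | hkl
  · exact (H.spread_of_le hN hkl h).symm
  · exact H.spread_of_le hN hkl h'

omit hN in
-- Peeling off first letters pushes the product down to products of two elements of `N` at depth
-- `k`, where the multiplication relations contribute `m` further levels.
theorem spread_mul_spread {k : ℕ} {g h : G} (hg : SecMem (X := X) N k g)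
    (hh : SecMem (X := X) N k h) :
    spread s t u k g * spread s t u k h = spread s t u (m + k) (g * h) := by
  induction k generalizing g h with
  | zero => exact H.mul g hg h hh
  | succ k ih =>
    rw [H.spread_succ_mul_spread_succ, ← Nat.add_assoc, spread]
    refine Finset.sum_congr rfl fun x _ => ?_
    rw [ih (hg _) (hh _), (letter_sec_mul g h x).1, (letter_sec_mul g h x).2]

omit H in
theorem secMem_mul (hm : ∀ g ∈ N, ∀ h ∈ N, SecMem (X := X) N m (g * h)) {k : ℕ} {g h : G}
    (hg : SecMem (X := X) N k g) (hh : SecMem (X := X) N k h) :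
    SecMem (X := X) N (m + k) (g * h) := by
  induction k generalizing g h with
  | zero => exact hm g hg h hh
  | succ k ih =>
    intro x
    rw [(letter_sec_mul g h x).2]
    exact ih (hg _) (hh _)

/-- The image of `u_g` for arbitrary `g` is its expansion at any depth where all sections are in
`N`. As the depth does not matter, each defining relation of `ℂ(G, X)` can be checked at the depth
that suits it. -/
theorem exists_algHom [Algebra ℂ B] (h1 : 1 ∈ N) (hd : ∀ g, ∃ k, SecMem (X := X) N k g)
    (hm : ∀ g ∈ N, ∀ h ∈ N, SecMem (X := X) N m (g * h)) :
    ∃ θ : SSAlgebra G X →ₐ[ℂ] B,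
      (∀ g ∈ N, θ (RingQuot.mkAlgHom ℂ (AlgRel G X) (FreeAlgebra.ι ℂ (.u g))) = u g) ∧
      (∀ x, θ (RingQuot.mkAlgHom ℂ (AlgRel G X) (FreeAlgebra.ι ℂ (.s x))) = s x) ∧
      (∀ x, θ (RingQuot.mkAlgHom ℂ (AlgRel G X) (FreeAlgebra.ι ℂ (.t x))) = t x) := by
  choose d hd using hd
  set U : G → B := fun g => spread s t u (d g) g with hU
  have hUk : ∀ {g k}, SecMem (X := X) N k g → U g = spread s t u k g := fun h =>
    H.spread_eq hN (hd _) h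
  have hU1 : U 1 = 1 := (hUk (k := 0) h1).trans H.one
  have hUs : ∀ g x, U g * s x = s (letter g x) * U (sec g x) := fun g x => by
    -- One level more than necessary, so that the first letter can be peeled off even if `g` is in
    -- `N`.
    have h := (hd g).succ hN
    rw [hUk h, hUk (h x), H.spread_succ_mul_s]
  have htU : ∀ g x, t (letter g x) * U g = U (sec g x) * t x := fun g x => by
    have h := (hd g).succ hN
    rw [hUk h, hUk (h x), H.t_mul_spread_succ]
  have hUm : ∀ g h, U g * U h = U (g * h) := fun g h => by
    -- The product formula needs both factors at the same depth.
    have hg := (hd g).mono hN (le_max_left (d g) (d h))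
    have hh := (hd h).mono hN (le_max_right (d g) (d h))
    rw [hUk hg, hUk hh, H.spread_mul_spread hg hh, hUk (secMem_mul hN hm hg hh)]
  let f : Gen G X → B := fun a => match a with
    | .u g => U g
    | .s x => s x
    | .t x => t x
  let θ : SSAlgebra G X →ₐ[ℂ] B := RingQuot.liftAlgHom ℂ ⟨FreeAlgebra.lift ℂ f, by
    intro a b h
    induction h <;> simp only [map_mul, map_one, map_zero, map_sum, FreeAlgebra.lift_ι_apply, f]
    case u_one => exact hU1
    case u_mul g h => exact hUm g h
    case u_s g x => exact hUs g x
    case t_u g x =>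
      -- `g⁻¹` maps the letter `g(x)` back to `x`, with section `(g|ₓ)⁻¹`.
      have h := htU g⁻¹ (letter g x)
      rwa [letter_inv_letter, sec_inv_letter] at h
    case t_s x => exact H.t_s x
    case t_s_ne x y h => exact H.t_s_ne x y h
    case sum_s_t => exact H.sum_s_t⟩
  have hθ : ∀ a, θ (RingQuot.mkAlgHom ℂ (AlgRel G X) (FreeAlgebra.ι ℂ a)) = f a := fun a => by
    simp only [θ, RingQuot.liftAlgHom_mkAlgHom_apply, FreeAlgebra.lift_ι_apply]
  exact ⟨θ, fun g hg => (hθ _).trans (hUk (k := 0) hg), fun x => hθ _, fun x => hθ _⟩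

end IsNucleusRep

end Spread

end SelfSimilar

/-! ### The degree of a germ -/

namespace PartialPerm

variable {Ω : Type*}

/-- The partial bijection `(x, n) ↦ (f x, n + d)`. -/
def shift (f : PartialPerm Ω) (d : ℤ) : PartialPerm (Ω × ℤ) :=
  (⟨fun p => (f p.1).map fun y => (y, p.2 + d), fun p => (star f p.1).map fun y => (y, p.2 - d), by
    rintro ⟨x, k⟩ ⟨y, l⟩
    simp only [Option.map_eq_some_iff, Prod.mk.injEq]
    constructor
    · rintro ⟨_, h, rfl, rfl⟩
      exact ⟨_, star_eq_some.1 h, rfl, by ring⟩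
    · rintro ⟨_, h, rfl, rfl⟩
      exact ⟨_, star_eq_some.2 h, rfl, by ring⟩⟩ : (Ω × ℤ) ≃. (Ω × ℤ))

theorem shift_eq_some {f : PartialPerm Ω} {d : ℤ} {x : Ω} {n : ℤ} {p : Ω × ℤ} :
    shift f d (x, n) = some p ↔ ∃ y, f x = some y ∧ p = (y, n + d) := by
  change (f x).map _ = some p ↔ _
  rw [Option.map_eq_some_iff]
  exact exists_congr fun y => and_congr_right fun _ => eq_comm

theorem eq_of_eq_some {f g : PartialPerm Ω} (h : ∀ x y, f x = some y ↔ g x = some y) : f = g :=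
  ext fun x => Option.ext fun y => h x y

theorem shift_mul_shift (f g : PartialPerm Ω) (d e : ℤ) :
    shift f d * shift g e = shift (f * g) (d + e) := by
  refine eq_of_eq_some ?_
  rintro ⟨x, n⟩ p
  simp only [mul_eq_some, shift_eq_some]
  constructor
  · rintro ⟨_, ⟨y, h, rfl⟩, h'⟩
    obtain ⟨z, hz, rfl⟩ := shift_eq_some.1 h'
    exact ⟨z, ⟨y, h, hz⟩, by rw [add_assoc, add_comm d e]⟩
  · rintro ⟨z, ⟨y, h, h'⟩, rfl⟩
    exact ⟨_, ⟨y, h, rfl⟩, shift_eq_some.2 ⟨z, h', by rw [add_assoc, add_comm d e]⟩⟩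

theorem shift_one_zero : shift (1 : PartialPerm Ω) 0 = 1 := by
  refine eq_of_eq_some ?_
  rintro ⟨x, n⟩ p
  rw [shift_eq_some, one_apply]
  simp [one_apply, eq_comm]

end PartialPerm

namespace SelfSimilar

section Degree

variable {G X : Type*} [Group G] [MulAction G (ℕ → X)]

/-- The degree of a generator: `1` for `s_x` and `-1` for `s_x*`. -/
def SGen.degree : SGen G X → ℤ
  | some (.s _) => 1
  | some (.t _) => -1
  | _ => 0

variable [SelfSimilarGroup G X]

variable (G X) in
/-- The action of `S(G, X)` on pairs of an infinite word and an integer, where the integer records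
the degree. -/
noncomputable def degreeHom : SMon G X →* PartialPerm ((ℕ → X) × ℤ) :=
  SMon.lift (fun a => PartialPerm.shift (genPerm a) (SGen.degree a)) <| by
    intro a b h
    -- The underlying relations hold for the action on words already, so what remains is that they
    -- are homogeneous, except where a zero occurs.
    have key : ∀ {p q : SMon G X} (d : ℤ), p = q →
        PartialPerm.shift (actHom G X p) d = PartialPerm.shift (actHom G X q) d :=
      fun d h => by rw [h]
    have k1 : ∀ {p : SMon G X}, p = 1 → PartialPerm.shift (actHom G X p) 0 = 1 := fun h => by
      rw [h, map_one, PartialPerm.shift_one_zero]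
    induction h <;> simp only [map_mul, map_one, FreeMonoid.lift_eval_of,
      PartialPerm.shift_mul_shift, SGen.degree]
    -- The two sides may carry different shifts, but a shift of the empty map is empty whatever its
    -- degree. The presence of zero is why the degree is recorded by an action on pairs and not by a
    -- homomorphism to `ℤ`.
    case zero_mul a => rw [genPerm, zero_mul]; rfl
    case mul_zero a => rw [genPerm, mul_zero]; rfl
    case u_one => exact k1 SMon.u_one
    case u_mul g h => exact key 0 (SMon.u_mul g h)
    case u_s g x => exact key 1 (SMon.u_s g x)
    case t_u g x => exact key (-1) (SMon.t_u g x)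
    case t_s x => exact k1 (SMon.t_s x)
    case t_s_ne x y h =>
      exact congrArg (fun p => PartialPerm.shift p 0) (congrArg (actHom G X) (SMon.t_s_ne h))

theorem degreeHom_of (a : SGen G X) : degreeHom G X (SMon.of a) =
    PartialPerm.shift (genPerm a) (SGen.degree a) := rfl

theorem degreeHom_mul_of {a b : SMon G X} {d e : ℤ}
    (ha : degreeHom G X a = PartialPerm.shift (actHom G X a) d)
    (hb : degreeHom G X b = PartialPerm.shift (actHom G X b) e) :
    degreeHom G X (a * b) = PartialPerm.shift (actHom G X (a * b)) (d + e) := by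
  rw [map_mul, map_mul, ha, hb, PartialPerm.shift_mul_shift]

/-- Uniqueness fails: if `a` acts as the empty map, every `d` is a degree. A degree is determined
only once a point of the domain is given. -/
theorem exists_degreeHom_eq (a : SMon G X) :
    ∃ d, degreeHom G X a = PartialPerm.shift (actHom G X a) d := by
  induction a using SMon.induction with
  | one => exact ⟨0, by rw [map_one, map_one, PartialPerm.shift_one_zero]⟩
  | mul a m h =>
    obtain ⟨d, h⟩ := h
    exact ⟨_, degreeHom_mul_of (degreeHom_of a) h⟩

theorem degreeHom_sw_mul_u (v : List X) (g : G) : degreeHom G X (SMon.sw G v * SMon.u X g) =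
    PartialPerm.shift (actHom G X (SMon.sw G v * SMon.u X g)) v.length := by
  have h : degreeHom G X (SMon.sw G v) =
      PartialPerm.shift (actHom G X (SMon.sw G v)) v.length := by
    induction v with
    | nil =>
      rw [SMon.sw, map_one, map_one, List.length_nil, Nat.cast_zero, PartialPerm.shift_one_zero]
    | cons x v ih =>
      have := degreeHom_mul_of (degreeHom_of (some (.s x))) ih
      rw [List.length_cons, Nat.cast_succ, add_comm]
      exact this
  have := degreeHom_mul_of h (degreeHom_of (some (.u g)))
  rwa [show SGen.degree (some (Gen.u g) : SGen G X) = 0 from rfl, add_zero] at this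

/-- If two elements have the same germ at `x`, they agree after multiplication by an idempotent `e`
defined at `x`. Following the point `(x, 0)` through the shifted action compares their degrees, the
degree of `e` appearing on both sides. -/
theorem degree_eq_of_germ_eq [TopologicalSpace X] [DiscreteTopology X] {a b : SMon G X} {d d' : ℤ}
    (ha : degreeHom G X a = PartialPerm.shift (actHom G X a) d)
    (hb : degreeHom G X b = PartialPerm.shift (actHom G X b) d')
    {γ : germGroupoid G X} (h : γ ∈ Germ.bisection a) (h' : γ ∈ Germ.bisection b) : d = d' := by
  obtain ⟨x, -, y, hx, rfl⟩ := h
  obtain ⟨x', -, y', hx', h⟩ := h'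
  obtain ⟨rfl, e, he, hex, hab⟩ := Germ.mk_eq_mk.1 h
  obtain ⟨k, hk⟩ := exists_degreeHom_eq e
  have hshift : ∀ {c : SMon G X} {z i n}, actHom G X c x = some z →
      PartialPerm.shift (actHom G X c) i (x, n) = some (z, n + i) := fun h =>
    PartialPerm.shift_eq_some.2 ⟨_, h, rfl⟩
  -- Idempotence and a nonempty domain give `k + k = k`.
  have hk0 : k = 0 := by
    have h1 := congrArg (degreeHom G X) he.eq
    rw [degreeHom_mul_of hk hk, he.eq, hk] at h1
    have h2 := hshift (i := k + k) (n := 0) hex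
    rw [h1, hshift (n := 0) hex, Option.some_inj, Prod.mk.injEq] at h2
    omega
  have hae : actHom G X (a * e) x = some y := PartialAction.act_mul_eq_some.2 ⟨x, hex, hx⟩
  have h1 := congrArg (degreeHom G X) hab
  rw [degreeHom_mul_of ha hk, degreeHom_mul_of hb hk, ← hab] at h1
  have h2 := hshift (i := d + k) (n := 0) hae
  rw [h1, hshift (n := 0) hae, Option.some_inj, Prod.mk.injEq] at h2
  omega

end Degree

/-! ### Calculus in `ℂ(G, X)` and its levels -/

namespace SSAlgebra

variable {G X : Type*} [Group G] [Fintype X] [MulAction G (ℕ → X)] [SelfSimilarGroup G X]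

/-- The elements `u_g` of `ℂ(G, X)`. -/
noncomputable def u (X : Type*) [Fintype X] [MulAction G (ℕ → X)] [SelfSimilarGroup G X] (g : G) :
    SSAlgebra G X := RingQuot.mkAlgHom ℂ (AlgRel G X) (FreeAlgebra.ι ℂ (.u g))

/-- The elements `s_x` of `ℂ(G, X)`. -/
noncomputable def s (G : Type*) [Group G] [MulAction G (ℕ → X)] [SelfSimilarGroup G X] (x : X) :
    SSAlgebra G X := RingQuot.mkAlgHom ℂ (AlgRel G X) (FreeAlgebra.ι ℂ (.s x))

/-- The elements `s_x*` of `ℂ(G, X)`. -/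
noncomputable def t (G : Type*) [Group G] [MulAction G (ℕ → X)] [SelfSimilarGroup G X] (x : X) :
    SSAlgebra G X := RingQuot.mkAlgHom ℂ (AlgRel G X) (FreeAlgebra.ι ℂ (.t x))

theorem u_one : u X (1 : G) = 1 := by
  simpa only [u, map_one] using RingQuot.mkAlgHom_rel ℂ (AlgRel.u_one (G := G) (X := X))

theorem u_mul (g h : G) : u X g * u X h = u X (g * h) := by
  simpa only [u, map_mul] using RingQuot.mkAlgHom_rel ℂ (AlgRel.u_mul (G := G) (X := X) g h)

theorem u_s (g : G) (x : X) : u X g * s G x = s G (letter g x) * u X (sec g x) := by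
  simpa only [u, s, map_mul] using RingQuot.mkAlgHom_rel ℂ (AlgRel.u_s (G := G) (X := X) g x)

theorem t_s (x : X) : t G x * s G x = 1 := by
  simpa only [s, t, map_mul, map_one] using RingQuot.mkAlgHom_rel ℂ (AlgRel.t_s (G := G) (X := X) x)

theorem t_s_ne {x y : X} (h : x ≠ y) : t G x * s G y = 0 := by
  simpa only [s, t, map_mul, map_zero] using
    RingQuot.mkAlgHom_rel ℂ (AlgRel.t_s_ne (G := G) (X := X) x y h)

theorem sum_s_t : ∑ x : X, s G x * t G x = 1 := by
  simpa only [s, t, map_mul, map_one, map_sum] using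
    RingQuot.mkAlgHom_rel ℂ (AlgRel.sum_s_t (G := G) (X := X))

theorem u_eq_spread (k : ℕ) (g : G) : u X g = spread (s G) (t G) (u X) k g := by
  induction k generalizing g with
  | zero => rfl
  | succ k ih =>
    rw [spread, ← mul_one (u X g), ← sum_s_t, Finset.mul_sum]
    exact Finset.sum_congr rfl fun x _ => by rw [← mul_assoc, u_s, ← ih]

theorem isNucleusRep (N : Set G) (m : ℕ) : IsNucleusRep N m (s G) (t G) (u X) where
  one := u_one
  t_s := t_s
  t_s_ne _ _ := t_s_ne
  sum_s_t := sum_s_t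
  expand g _ := u_eq_spread 1 g
  mul g _ h _ := by rw [u_mul, ← u_eq_spread]

theorem gen_induction {p : SSAlgebra G X → Prop} (one : p 1)
    (add : ∀ a b, p a → p b → p (a + b)) (smul : ∀ (c : ℂ) a, p a → p (c • a))
    (u_mul : ∀ g a, p a → p (u X g * a)) (s_mul : ∀ x a, p a → p (s G x * a))
    (t_mul : ∀ x a, p a → p (t G x * a)) (a : SSAlgebra G X) : p a := by
  obtain ⟨a, rfl⟩ := RingQuot.mkAlgHom_surjective ℂ (AlgRel G X) a
  -- Preserving `p` under left multiplication passes to products and sums, so it only has to be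
  -- known for scalars and generators.
  suffices h : ∀ b, p b → p (RingQuot.mkAlgHom ℂ (AlgRel G X) a * b) by simpa using h 1 one
  induction a using FreeAlgebra.induction with
  | grade0 r =>
    intro b hb
    rw [AlgHom.commutes, ← Algebra.smul_def]
    exact smul r b hb
  | grade1 a =>
    rcases a with g | x | x
    · exact u_mul g
    · exact s_mul x
    · exact t_mul x
  | mul a b ha hb =>
    intro c hc
    rw [map_mul, mul_assoc]
    exact ha _ (hb c hc)
  | add a b ha hb =>
    intro c hc
    rw [map_add, add_mul]
    exact add _ _ (ha c hc) (hb c hc)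

/-- The elements `s_v` of `ℂ(G, X)`, for words `v`. -/
noncomputable def sw (G : Type*) [Group G] [MulAction G (ℕ → X)] [SelfSimilarGroup G X] :
    List X → SSAlgebra G X
  | [] => 1
  | x :: v => s G x * sw G v

theorem sw_mul_s (v : List X) (x : X) : sw G v * s G x = sw G (v ++ [x]) := by
  induction v with
  | nil => rw [List.nil_append, sw, sw, sw, one_mul, mul_one]
  | cons y v ih => rw [List.cons_append, sw, sw, mul_assoc, ih]

theorem exists_u_mul_sw (g : G) (v : List X) :
    ∃ v' h, u X g * sw G v = sw G v' * u X h := by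
  induction v generalizing g with
  | nil => exact ⟨[], g, by rw [sw, mul_one, one_mul]⟩
  | cons x v ih =>
    obtain ⟨v', h, e⟩ := ih (sec g x)
    exact ⟨letter g x :: v', h, by rw [sw, sw, ← mul_assoc, u_s, mul_assoc, e, mul_assoc]⟩

theorem t_mul_s_mul (x y : X) (a : SSAlgebra G X) :
    t G x * (s G y * a) = a ∨ t G x * (s G y * a) = 0 := by
  rw [← mul_assoc]
  by_cases h : x = y
  · rw [h, t_s, one_mul]; exact Or.inl rfl
  · rw [t_s_ne h, zero_mul]; exact Or.inr rfl

variable (X) in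
/-- The span of the elements `s_v u_g` for words `v` of length `k` and `g ∈ N`. -/
noncomputable def level (N : Set G) (k : ℕ) : Submodule ℂ (SSAlgebra G X) :=
  Submodule.span ℂ {a | ∃ v : List X, v.length = k ∧ ∃ g ∈ N, a = sw G v * u X g}

theorem level_zero (N : Set G) : level X N 0 = Submodule.span ℂ (u X '' N) := by
  rw [level]
  congr 1
  ext a
  constructor
  · rintro ⟨v, hv, g, hg, rfl⟩
    obtain rfl := List.length_eq_zero_iff.1 hv
    exact ⟨g, hg, by rw [sw, one_mul]⟩
  · rintro ⟨g, hg, rfl⟩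
    exact ⟨[], rfl, g, hg, by rw [sw, one_mul]⟩

/-- Multiplication by `s_x*` either strips the first letter of `v` or gives zero; this is the
downward step in the induction on the degree. -/
theorem t_mul_mem_level {N : Set G} {k : ℕ} {a : SSAlgebra G X} (ha : a ∈ level X N (k + 1))
    (x : X) : t G x * a ∈ level X N k := by
  induction ha using Submodule.span_induction with
  | mem a h =>
    obtain ⟨v, hv, g, hg, rfl⟩ := h
    obtain ⟨y, v, rfl⟩ := List.exists_cons_of_length_eq_add_one hv
    rw [sw, mul_assoc (s G y)]
    rcases t_mul_s_mul x y (sw G v * u X g) with h | h <;> rw [h]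
    · exact Submodule.subset_span ⟨v, by simpa using hv, g, hg, rfl⟩
    · exact zero_mem _
  | zero => rw [mul_zero]; exact zero_mem _
  | add a b _ _ ha hb => rw [mul_add]; exact add_mem ha hb
  | smul c a _ ha => rw [mul_smul_comm]; exact Submodule.smul_mem _ _ ha

/-- The elements `a` with `a s_w` in the span of the elements `s_v u_g` with `g ∈ N`, for all the
words `w` in some complete prefix code. -/
inductive Reducible (N : Set G) : SSAlgebra G X → Prop
  | mem {a} (h : a ∈ ⨆ k, level X N k) : Reducible N a
  | mul_s {a} (h : ∀ x, Reducible N (a * s G x)) : Reducible N a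

/-! ### Reduction to the levels along complete prefix codes -/

section Reduction

variable {N : Set G} (hN : ∀ g ∈ N, ∀ x : X, sec g x ∈ N)

theorem sw_mul_u_mem_iSup (v : List X) {g : G} (hg : g ∈ N) :
    sw G v * u X g ∈ ⨆ k, level X N k :=
  le_iSup (level X N) v.length (Submodule.subset_span ⟨v, rfl, g, hg, rfl⟩)

theorem iSup_level_induction {p : SSAlgebra G X → Prop} (zero : p 0)
    (sw_u : ∀ (v : List X), ∀ g ∈ N, p (sw G v * u X g)) (add : ∀ a b, p a → p b → p (a + b))
    (smul : ∀ (c : ℂ) a, p a → p (c • a)) {a : SSAlgebra G X} (ha : a ∈ ⨆ k, level X N k) :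
    p a := by
  induction ha using Submodule.iSup_induction' with
  | mem k a ha =>
    induction ha using Submodule.span_induction with
    | mem a h =>
      obtain ⟨v, -, g, hg, rfl⟩ := h
      exact sw_u v g hg
    | zero => exact zero
    | add a b _ _ ha hb => exact add a b ha hb
    | smul c a _ ha => exact smul c a ha
  | zero => exact zero
  | add a b _ _ ha hb => exact add a b ha hb

include hN in
-- Since `N` is closed under sections, moving `s_x` to the left past `u_g` stays within the levels.
-- So a prefix code that works may be refined.
theorem mul_s_mem_iSup {a : SSAlgebra G X} (ha : a ∈ ⨆ k, level X N k) (x : X) :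
    a * s G x ∈ ⨆ k, level X N k := by
  refine iSup_level_induction (p := fun a => a * s G x ∈ ⨆ k, level X N k) ?_ (fun v g hg => ?_)
    (fun a b ha hb => ?_) (fun c a ha => ?_) ha
  · rw [zero_mul]; exact zero_mem _
  · rw [mul_assoc, u_s, ← mul_assoc, sw_mul_s]
    exact sw_mul_u_mem_iSup _ (hN g hg x)
  · rw [add_mul]; exact add_mem ha hb
  · rw [smul_mul_assoc]; exact Submodule.smul_mem _ _ ha

namespace Reducible

theorem smul {a : SSAlgebra G X} (ha : Reducible N a) (c : ℂ) : Reducible N (c • a) := by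
  induction ha with
  | mem h => exact mem (Submodule.smul_mem _ _ h)
  | mul_s _ ih => exact mul_s fun x => by rw [smul_mul_assoc]; exact ih x

include hN in
theorem mul_s' {a : SSAlgebra G X} (ha : Reducible N a) (x : X) : Reducible N (a * s G x) := by
  cases ha with
  | mem h => exact mem (mul_s_mem_iSup hN h x)
  | mul_s h => exact h x

include hN in
-- The double induction builds a common refinement of the two prefix codes.
theorem add {a b : SSAlgebra G X} (ha : Reducible N a) (hb : Reducible N b) :
    Reducible N (a + b) := by
  induction ha generalizing b with
  | @mem a h =>
    induction hb generalizing a with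
    | mem h' => exact mem (add_mem h h')
    | mul_s _ ih =>
      exact mul_s fun x => by rw [add_mul]; exact ih x (mul_s_mem_iSup hN h x)
  | mul_s _ ih => exact mul_s fun x => by rw [add_mul]; exact ih x (hb.mul_s' hN x)

theorem sw_mul_u {k : ℕ} (v : List X) {g : G} (hg : SecMem (X := X) N k g) :
    Reducible N (sw G v * u X g) := by
  induction k generalizing v g with
  | zero => exact mem (sw_mul_u_mem_iSup v hg)
  | succ k ih =>
    exact mul_s fun x => by
      rw [mul_assoc, u_s, ← mul_assoc, sw_mul_s]
      exact ih _ (hg x)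

include hN in
-- By induction on left multiplication by generators. Multiplying `s_v u_n` by a generator gives
-- some `s_{v'} u_{g'}`, zero, or `s_x* u_n`; the group element may leave `N`, but finitely many
-- further letters bring its sections back.
theorem of_secMem (hd : ∀ g, ∃ k, SecMem (X := X) N k g) (a : SSAlgebra G X) :
    Reducible N a := by
  have hsw : ∀ (v : List X) (g : G), Reducible N (sw G v * u X g) := fun v g =>
    sw_mul_u v (hd g).choose_spec
  -- Left and right multiplication commute, so the prefix code of `a` can be used for `b a`, and
  -- only the spanning elements of the levels need to be examined.
  have key : ∀ b : SSAlgebra G X, (∀ (v : List X), ∀ g ∈ N, Reducible N (b * (sw G v * u X g))) →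
      ∀ a, Reducible N a → Reducible N (b * a) := by
    intro b hb a ha
    induction ha with
    | mem h =>
      refine iSup_level_induction (p := fun a => Reducible N (b * a)) ?_ hb
        (fun a a' ha ha' => ?_) (fun c a ha => ?_) h
      · rw [mul_zero]; exact mem (zero_mem _)
      · rw [mul_add]; exact ha.add hN ha'
      · rw [mul_smul_comm]; exact ha.smul c
    | mul_s _ ih => exact mul_s fun x => by rw [mul_assoc]; exact ih x
  induction a using gen_induction with
  | one =>
    have h := hsw [] 1
    rwa [sw, u_one, one_mul] at h
  | add a b ha hb => exact ha.add hN hb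
  | smul c a ha => exact ha.smul c
  | u_mul g a ha =>
    refine key _ (fun v h _ => ?_) a ha
    obtain ⟨v', g', e⟩ := exists_u_mul_sw g v
    rw [← mul_assoc, e, mul_assoc, u_mul]
    exact hsw _ _
  | s_mul x a ha =>
    refine key _ (fun v h _ => ?_) a ha
    rw [← mul_assoc]
    exact hsw (x :: v) h
  | t_mul x a ha =>
    refine key _ (fun v h _ => ?_) a ha
    have ht : ∀ (y : X) (v : List X) (g : G), Reducible N (t G x * (s G y * (sw G v * u X g))) := by
      intro y v g
      rcases t_mul_s_mul x y (sw G v * u X g) with h | h <;> rw [h]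
      · exact hsw v g
      · exact mem (zero_mem _)
    rcases v with _ | ⟨y, v⟩
    -- In `s_x* u_h` there is no letter to cancel; one more `s_y` on the right turns it into `s_x*
    -- s_{h(y)} u_{h|_y}`.
    · refine mul_s fun y => ?_
      have h' := ht (letter h y) [] (sec h y)
      rwa [sw, one_mul, ← u_s, ← mul_assoc, ← one_mul (u X h)] at h'
    · rw [sw, mul_assoc (s G y)]
      exact ht y v h

end Reducible

end Reduction

/-! ### Homogeneous components and generators of the essential ideal -/

section Essential

variable [TopologicalSpace X] [DiscreteTopology X]

theorem toGroupoidAlgebra_gen (a : Gen G X) : (toGroupoidAlgebra G X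
    (RingQuot.mkAlgHom ℂ (AlgRel G X) (FreeAlgebra.ι ℂ a))).1 = Germ.ind1 (SMon.of (some a)) := by
  rw [toGroupoidAlgebra, RingQuot.liftAlgHom_mkAlgHom_apply, FreeAlgebra.lift_ι_apply]
  rfl

theorem toGroupoidAlgebra_sw_mul_u (v : List X) (g : G) :
    (toGroupoidAlgebra G X (sw G v * u X g)).1 = Germ.ind1 (SMon.sw G v * SMon.u X g) := by
  have h : (toGroupoidAlgebra G X (sw G v)).1 = Germ.ind1 (SMon.sw G v) := by
    induction v with
    | nil => rw [sw, SMon.sw, map_one, Germ.ind1_one]; rfl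
    | cons x v ih =>
      rw [sw, SMon.sw, map_mul, ← Germ.ind1_mul, ← ih]
      exact congrArg (· * _) (toGroupoidAlgebra_gen _)
  rw [map_mul, ← Germ.ind1_mul, ← h]
  exact congrArg (_ * ·) (toGroupoidAlgebra_gen _)

/-- The spanning elements of a level map to indicator functions of bisections of degree `k`, and
vanishing at `γ` is a linear condition. Hence level `k` is supported on germs of degree `k`. -/
theorem degree_of_apply_ne_zero {N : Set G} {k : ℕ} {a : SSAlgebra G X} (ha : a ∈ level X N k)
    {γ : germGroupoid G X} (h : (toGroupoidAlgebra G X a).1 γ ≠ 0) : ∃ (v : List X) (g : G),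
      v.length = k ∧ γ ∈ Germ.bisection (SMon.sw G v * SMon.u X g) := by
  contrapose! h
  induction ha using Submodule.span_induction with
  | mem a ha =>
    obtain ⟨v, hv, g, -, rfl⟩ := ha
    rw [toGroupoidAlgebra_sw_mul_u]
    exact Set.indicator_of_notMem (h v g hv) _
  | zero => rw [map_zero]; rfl
  | add a b _ _ ha hb =>
    rw [map_add]
    exact (congrArg₂ (· + ·) ha hb).trans (add_zero 0)
  | smul c a _ ha =>
    rw [map_smul]
    exact (congrArg (c * ·) ha).trans (mul_zero c)

/-- The homogeneous components of an element of the essential ideal are in the essential ideal. -/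
theorem component_mem_algEssentialIdeal {N : Set G} {f : ℕ →₀ SSAlgebra G X}
    (hf : ∀ k, f k ∈ level X N k) (h : (f.sum fun _ a => a) ∈ algEssentialIdeal G X) (k : ℕ) :
    f k ∈ algEssentialIdeal G X := by
  rw [mem_algEssentialIdeal] at h ⊢
  refine Set.subset_eq_empty (interior_mono fun γ hγ => ?_) h
  have hγ' : (toGroupoidAlgebra G X (f k)).1 γ ≠ 0 := hγ
  obtain ⟨v, g, hv, hm⟩ := degree_of_apply_ne_zero (hf k) hγ'
  -- As `γ` has only one degree, no other component contributes at `γ`; the strict support of `f k`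
  -- is thus contained in that of the sum.
  have h0 : ∀ l, l ≠ k → (toGroupoidAlgebra G X (f l)).1 γ = 0 := by
    intro l hl
    by_contra hne
    obtain ⟨v', g', hv', hm'⟩ := degree_of_apply_ne_zero (hf l) hne
    have := degree_eq_of_germ_eq (degreeHom_sw_mul_u v' g') (degreeHom_sw_mul_u v g) hm' hm
    rw [hv, hv'] at this
    exact hl (by exact_mod_cast this)
  have hs : (toGroupoidAlgebra G X (f.sum fun _ a => a)).1 γ =
      (toGroupoidAlgebra G X (f k)).1 γ := by
    rw [Finsupp.sum, map_sum, AddSubmonoidClass.coe_finsetSum, Submodule.coe_sum, Finset.sum_apply]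
    refine Finset.sum_eq_single k (fun l _ hl => h0 l hl) fun hk => ?_
    rw [Finsupp.notMem_support_iff.1 hk, map_zero]; rfl
  exact hs.trans_ne hγ'

/-- The essential ideal is generated by its intersection with the span of the elements `u_g` with
`g` in the nucleus. -/
theorem eq_zero_of_mem_algEssentialIdeal {B : Type*} [Ring B] [Algebra ℂ B]
    (θ : SSAlgebra G X →ₐ[ℂ] B) {N : Set G} (hN : ∀ g ∈ N, ∀ x : X, sec g x ∈ N)
    (hd : ∀ g, ∃ k, SecMem (X := X) N k g)
    (hθ : ∀ a ∈ Submodule.span ℂ (u X '' N), a ∈ algEssentialIdeal G X → θ a = 0)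
    {a : SSAlgebra G X} (ha : a ∈ algEssentialIdeal G X) : θ a = 0 := by
  have hlevel : ∀ k, ∀ a ∈ level X N k, a ∈ algEssentialIdeal G X → θ a = 0 := by
    intro k
    induction k with
    | zero => rwa [level_zero]
    | succ k ih =>
      intro a hk ha
      -- Each `s_x* a` is again in the ideal and one level lower.
      rw [← one_mul a, ← sum_s_t, Finset.sum_mul, map_sum]
      refine Finset.sum_eq_zero fun x _ => ?_
      rw [mul_assoc, map_mul, ih _ (t_mul_mem_level hk x) (TwoSidedIdeal.mul_mem_left _ _ _ ha),
        mul_zero]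
  induction Reducible.of_secMem hN hd a with
  | mem h =>
    obtain ⟨f, hf, rfl⟩ := (Submodule.mem_iSup_iff_exists_finsupp _ _).1 h
    rw [Finsupp.sum, map_sum]
    exact Finset.sum_eq_zero fun k _ =>
      hlevel k _ (hf k) (component_mem_algEssentialIdeal hf ha k)
  | @mul_s a _ ih =>
    -- Each `a s_x` is again in the ideal and closer to the leaves of the prefix code; multiplying
    -- back by `s_x*` and summing recovers `a`.
    rw [← mul_one a, ← sum_s_t, Finset.mul_sum, map_sum]
    refine Finset.sum_eq_zero fun x _ => ?_
    rw [← mul_assoc, map_mul, ih x (TwoSidedIdeal.mul_mem_right _ _ _ ha), zero_mul]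

end Essential

end SSAlgebra

end SelfSimilar

/-! ### Assembling the finite presentation -/

theorem IsFinitelyPresentedAlgebra.of_finite {k A ι : Type*} [Field k] [Ring A] [Algebra k A]
    [Finite ι] (φ : FreeAlgebra k ι →ₐ[k] A) (hφ : Function.Surjective φ)
    {R : Set (FreeAlgebra k ι)} (hR : R.Finite) (h : TwoSidedIdeal.ker φ = TwoSidedIdeal.span R) :
    IsFinitelyPresentedAlgebra k A := by
  obtain ⟨n, ⟨e⟩⟩ := Finite.exists_equiv_fin ι
  let E : FreeAlgebra k (Fin n) ≃ₐ[k] FreeAlgebra k ι := AlgEquiv.ofAlgHom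
    (FreeAlgebra.lift k (FreeAlgebra.ι k ∘ e.symm)) (FreeAlgebra.lift k (FreeAlgebra.ι k ∘ e))
    (by ext; simp) (by ext; simp)
  refine ⟨n, φ.comp (E : FreeAlgebra k (Fin n) →ₐ[k] FreeAlgebra k ι), E.symm '' R,
    hφ.comp E.surjective, hR.image _, ?_⟩
  refine le_antisymm (fun x hx => ?_) (TwoSidedIdeal.span_le.2 ?_)
  · have h1 : E x ∈ TwoSidedIdeal.span R := by
      rw [← h, TwoSidedIdeal.mem_ker]
      exact (TwoSidedIdeal.mem_ker (φ.comp (E : FreeAlgebra k (Fin n) →ₐ[k] FreeAlgebra k ι))).1 hx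
    rw [TwoSidedIdeal.mem_span_iff] at h1 ⊢
    intro I hI
    -- The span is the intersection of all ideals that contain `R`, so it can be transported by
    -- pulling back each such ideal.
    have h2 := h1 (I.comap E.symm) fun r hr => by
      rw [SetLike.mem_coe, TwoSidedIdeal.mem_comap]
      exact hI ⟨r, hr, rfl⟩
    rwa [TwoSidedIdeal.mem_comap, E.symm_apply_apply] at h2
  · rintro _ ⟨r, hr, rfl⟩
    have h1 : r ∈ TwoSidedIdeal.ker φ := h ▸ TwoSidedIdeal.subset_span hr
    rw [SetLike.mem_coe, TwoSidedIdeal.mem_ker]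
    change φ (E (E.symm r)) = 0
    rw [E.apply_symm_apply]
    exact (TwoSidedIdeal.mem_ker _).1 h1

theorem TwoSidedIdeal.mkₐ_eq_zero_iff {k A : Type*} [CommRing k] [Ring A] [Algebra k A]
    (I : TwoSidedIdeal A) (a : A) : I.ringCon.mkₐ k a = 0 ↔ a ∈ I := by
  rw [TwoSidedIdeal.mem_iff, ← RingCon.eq]
  rfl

namespace SelfSimilar

variable {G X : Type*} [Group G] [Fintype X] [MulAction G (ℕ → X)] [SelfSimilarGroup G X]

/-- The relators which express that the elements `s_x`, `t_x` and `u_g` satisfy the relations in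
`IsNucleusRep`. -/
def nucleusRelators {F : Type*} [Ring F] (N : Set G) (m : ℕ) (s t : X → F) (u : G → F) : Set F :=
  {u 1 - 1, ∑ x, s x * t x - 1} ∪ Set.range (fun x => t x * s x - 1) ∪
    (fun p : X × X => t p.1 * s p.2) '' {p | p.1 ≠ p.2} ∪ (fun g => u g - spread s t u 1 g) '' N ∪
    Set.image2 (fun g h => u g * u h - spread s t u m (g * h)) N N

theorem finite_nucleusRelators {F : Type*} [Ring F] {N : Set G} (hN : N.Finite) (m : ℕ)
    (s t : X → F) (u : G → F) : (nucleusRelators N m s t u).Finite :=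
  ((((Set.toFinite _).union (Set.finite_range _)).union ((Set.toFinite _).image _)).union
    (hN.image _)).union (hN.image2 _ hN)

/-- Used in both directions: to obtain a representation in the quotient of the free algebra by the
relators, and to see that the relators vanish in `ℂ(G, X)`. -/
theorem nucleusRelators_subset_ker_iff {F B : Type*} [Ring F] [Ring B] [Algebra ℂ F] [Algebra ℂ B]
    (φ : F →ₐ[ℂ] B) (N : Set G) (m : ℕ) (s t : X → F) (u : G → F) :
    (∀ r ∈ nucleusRelators N m s t u, φ r = 0) ↔
      IsNucleusRep N m (fun x => φ (s x)) (fun x => φ (t x)) (fun g => φ (u g)) := by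
  constructor
  · intro h
    refine ⟨?_, fun x => ?_, fun x y hxy => ?_, ?_, fun g hg => ?_, fun g hg g' hg' => ?_⟩
    · simpa [sub_eq_zero] using h _ (.inl (.inl (.inl (.inl (.inl rfl)))))
    · simpa [sub_eq_zero] using h _ (.inl (.inl (.inl (.inr ⟨x, rfl⟩))))
    · simpa using h _ (.inl (.inl (.inr ⟨(x, y), hxy, rfl⟩)))
    · simpa [sub_eq_zero] using h _ (.inl (.inl (.inl (.inl (.inr rfl)))))
    · simpa only [map_sub, sub_eq_zero, map_spread] using h _ (.inl (.inr ⟨g, hg, rfl⟩))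
    · simpa only [map_sub, map_mul, sub_eq_zero, map_spread] using
        h _ (.inr ⟨g, hg, g', hg', rfl⟩)
  · rintro H r (((((rfl | rfl) | ⟨x, rfl⟩) | ⟨⟨x, y⟩, hxy, rfl⟩) | ⟨g, hg, rfl⟩) |
      ⟨g, hg, g', hg', rfl⟩)
    · simpa [sub_eq_zero] using H.one
    · simpa [sub_eq_zero] using H.sum_s_t
    · simpa [sub_eq_zero] using H.t_s x
    · simpa using H.t_s_ne x y hxy
    · simpa only [map_sub, sub_eq_zero, map_spread] using H.expand g hg
    · simpa only [map_sub, map_mul, sub_eq_zero, map_spread] using H.mul g hg g' hg'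

end SelfSimilar

open SelfSimilar in
theorem mainTheorem5 {G X : Type*} [Group G] [Fintype X] [TopologicalSpace X] [DiscreteTopology X]
    [MulAction G (ℕ → X)] [SelfSimilar.SelfSimilarGroup G X]
    (hG : SelfSimilar.IsContracting G X) :
    IsFinitelyPresentedAlgebra ℂ (SelfSimilar.algEssentialIdeal G X).ringCon.Quotient := by
  classical
  obtain ⟨N, m, hf, h1, hN, hd, hm⟩ := hG.exists_nucleus
  have : Finite N := hf
  let F := FreeAlgebra ℂ (N ⊕ X ⊕ X)
  let s : X → F := fun x => FreeAlgebra.ι ℂ (.inr (.inl x))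
  let t : X → F := fun x => FreeAlgebra.ι ℂ (.inr (.inr x))
  let u : G → F := fun g => if h : g ∈ N then FreeAlgebra.ι ℂ (.inl ⟨g, h⟩) else 0
  have hu : ∀ n : N, u n = FreeAlgebra.ι ℂ (.inl n) := fun n => dif_pos n.2
  let ψ : F →ₐ[ℂ] SSAlgebra G X := FreeAlgebra.lift ℂ
    (Sum.elim (fun n => SSAlgebra.u X n.1) (Sum.elim (SSAlgebra.s G) (SSAlgebra.t G)))
  have hψs : ∀ x, ψ (s x) = SSAlgebra.s G x := fun x => FreeAlgebra.lift_ι_apply _ _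
  have hψt : ∀ x, ψ (t x) = SSAlgebra.t G x := fun x => FreeAlgebra.lift_ι_apply _ _
  have hψu : ∀ g ∈ N, ψ (u g) = SSAlgebra.u X g := fun g hg => by
    rw [hu ⟨g, hg⟩]; exact FreeAlgebra.lift_ι_apply _ _
  have hψsurj : Function.Surjective ψ := by
    intro a
    induction a using SSAlgebra.gen_induction with
    | one => exact ⟨1, map_one ψ⟩
    | add a b ha hb =>
      obtain ⟨⟨a, rfl⟩, b, rfl⟩ := ha, hb
      exact ⟨a + b, map_add ψ a b⟩
    | smul c a ha =>
      obtain ⟨a, rfl⟩ := ha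
      exact ⟨c • a, map_smul ψ c a⟩
    | u_mul g a ha =>
      obtain ⟨a, rfl⟩ := ha
      obtain ⟨k, hk⟩ := hd g
      refine ⟨spread s t u k g * a, ?_⟩
      rw [map_mul, map_spread, spread_congr _ _ hψu hk, funext hψs, funext hψt,
        ← SSAlgebra.u_eq_spread]
    | s_mul x a ha =>
      obtain ⟨a, rfl⟩ := ha
      exact ⟨s x * a, by rw [map_mul, hψs]⟩
    | t_mul x a ha =>
      obtain ⟨a, rfl⟩ := ha
      exact ⟨t x * a, by rw [map_mul, hψt]⟩
  let q := (algEssentialIdeal G X).ringCon.mkₐ ℂ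
  have hq : ∀ a, q a = 0 ↔ a ∈ algEssentialIdeal G X :=
    TwoSidedIdeal.mkₐ_eq_zero_iff (k := ℂ) _
  -- The lift to the free algebra of the part of the essential ideal in the span of the `u_n`; it is
  -- finite-dimensional because `N` is finite, and `S` spans it.
  let W : Submodule ℂ F := Submodule.span ℂ (u '' N) ⊓ LinearMap.ker (q.comp ψ).toLinearMap
  have hW : W.FG := by
    have := FiniteDimensional.span_of_finite ℂ (hf.image u)
    have := Submodule.finiteDimensional_inf_left (Submodule.span ℂ (u '' N))
      (LinearMap.ker (q.comp ψ).toLinearMap)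
    exact (Submodule.fg_iff_finiteDimensional W).2 this
  obtain ⟨S, hS⟩ := hW
  let R : Set F := nucleusRelators N m s t u ∪ S
  refine .of_finite (q.comp ψ) ((RingCon.mkₐ_surjective (α := ℂ) _).comp hψsurj)
    ((finite_nucleusRelators hf m s t u).union S.finite_toSet) (R := R) (le_antisymm ?_ ?_)
  -- The quotient map by the relators factors as `θ ∘ ψ` through `ℂ(G, X)`, so it suffices that `θ`
  -- vanishes on the essential ideal, and this is tested on the span of the `u_n`.
  · let π := (TwoSidedIdeal.span R).ringCon.mkₐ ℂ
    have hπ : ∀ a, π a = 0 ↔ a ∈ TwoSidedIdeal.span R :=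
    TwoSidedIdeal.mkₐ_eq_zero_iff (k := ℂ) _
    have hrep := (nucleusRelators_subset_ker_iff π N m s t u).1 fun r hr =>
      (hπ r).2 (TwoSidedIdeal.subset_span (.inl hr))
    obtain ⟨θ, hθu, hθs, hθt⟩ := hrep.exists_algHom hN h1 hd hm
    have hθψ : θ.comp ψ = π := by
      refine FreeAlgebra.hom_ext (funext ?_)
      rintro (n | x | x)
      · have h := hθu n n.2
        rw [hu] at h
        exact (congrArg θ (FreeAlgebra.lift_ι_apply _ _)).trans h
      · exact (congrArg θ (hψs x)).trans (hθs x)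
      · exact (congrArg θ (hψt x)).trans (hθt x)
    have hWπ : ∀ a ∈ W, π a = 0 := by
      have h : W ≤ LinearMap.ker π.toLinearMap := by
        rw [← hS, Submodule.span_le]
        exact fun a ha => (hπ a).2 (TwoSidedIdeal.subset_span (.inr ha))
      exact fun a ha => h ha
    intro a ha
    rw [TwoSidedIdeal.mem_ker] at ha
    rw [← hπ, ← hθψ]
    refine SSAlgebra.eq_zero_of_mem_algEssentialIdeal θ hN hd ?_ ((hq _).1 ha)
    intro b hb hbI
    -- Each element of this span lifts to a combination of free generators; if it is in the
    -- essential ideal, the lift is in `W`.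
    have hspan : Submodule.span ℂ (SSAlgebra.u X '' N) =
        (Submodule.span ℂ (u '' N)).map ψ.toLinearMap := by
      rw [Submodule.map_span, Set.image_image]
      exact congrArg _ (Set.image_congr fun g hg => (hψu g hg).symm)
    rw [hspan] at hb
    obtain ⟨b, hb, rfl⟩ := hb
    exact (DFunLike.congr_fun hθψ b).trans (hWπ b ⟨hb, (hq _).2 hbI⟩)
  · rw [TwoSidedIdeal.span_le]
    rintro r (hr | hr) <;> rw [SetLike.mem_coe, TwoSidedIdeal.mem_ker]
    · have hrep : IsNucleusRep N m (fun x => ψ (s x)) (fun x => ψ (t x)) (fun g => ψ (u g)) := by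
        rw [funext hψs, funext hψt]
        -- The images of `u` are the true `u_g` on `N` but zero elsewhere, which the relations do
        -- not see.
        exact (SSAlgebra.isNucleusRep N m).congr hN h1 hm fun g hg => (hψu g hg).symm
      have h := (nucleusRelators_subset_ker_iff ψ N m s t u).2 hrep r hr
      rw [AlgHom.comp_apply, h, map_zero]
    · have h : r ∈ W := hS ▸ Submodule.subset_span hr
      exact h.2
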